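/- **Setting.** Let $T>0$, let $(\Omega,\mathcal F,\mathbb F=(\mathcal F_t)_{t\in[0,T]})$ be a filtered measurable space, let $\mathcal I=\{1,\dots,n,C\}$, and let $\mathbb P_k$, $k\in\mathcal I$, be equivalent probability measures on $\mathcal F$ for which $\mathbb F$ is complete (every null set belongs to $\mathcal F_0$). Let $N(d\xi,dt)$ be a random measure on $\mathbb R_+\times[0,T]$, $\mathbb R_+=(0,\infty)$, which under each $\mathbb P_k$ is a Poisson random measure relative to $\mathbb F$ with compensator $\nu_k(d\xi)\,dt$, $\nu_k(d\xi)=v_k(\xi)\,d\xi$, where $v_k\ge 0$ is measurable on $\mathbb R_+$; put $\tilde N^{\mathbb P_k}(d\xi,dt)=N(d\xi,dt)-\nu_k(d\xi)\,dt$. (By equivalence the sets $\{v_k=0\}$ agree up to null sets; quotients by $v_k$ are read as $0$ there.) Assume $\int_{\mathbb R_+}\nu_k(d\xi)<\infty$ and $\int_{\mathbb R_+}\xi\,\nu_k(d\xi)<\infty$ for all $k\in\mathcal I$, $\int_{\mathbb R_+}\xi^2\,\nu_C(d\xi)<\infty$, and $$\int_{\mathbb R_+}\frac{v_C^2(\xi)}{v_k(\xi)}\,d\xi<\infty,\qquad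 \int_{\mathbb R_+}\frac{v_C^3(\xi)}{v_j(\xi)v_k(\xi)}\,d\xi<\infty\qquad\text{for all } j,k\in\mathcal I.$$ Let $\theta>0$, $\eta>0$, and $\pi_k\in[0,1]$ with $\sum_{k\in\mathcal I}\pi_k=1$. **Admissible controls.** $\mathcal A$ is the set of $\mathbb F$-predictable random fields $\alpha_t:\mathbb R_+\to\mathbb R$, $t\in[0,T]$, with $$\mathbb E^{\mathbb P_C}\Big[\int_0^T\!\!\int_{\mathbb R_+}|\alpha_s(\xi)|^2\,\nu_C(d\xi)\,ds\Big]<\infty,\qquad \mathbb E^{\mathbb P_C}\Big[\int_0^T\!\!\int_{\mathbb R_+}[\xi-\alpha_s(\xi)]^2\,\nu_C(d\xi)\,ds\Big]<\infty .$$ $\mathcal B$ is the set of nonnegative $\mathbb F$-predictable random fields $\beta_t$ on $\mathbb R_+$ with $\mathbb E^{\mathbb P_k}\big[\int_0^T\int_{\mathbb R_+}[1-\beta_s(\xi)/v_k(\xi)]^2\,\nu_k(d\xi)\,ds\big]<\infty$ for all $k\in\mathcal I$. For $\beta\in\mathcal B$, $Z^\beta_k$ denotes the adapted càdlàg solution on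 $[0,T]$ of $$dZ^\beta_{k,t}=-Z^\beta_{k,t^-}\int_{\mathbb R_+}\Big[1-\frac{\beta_t(\xi)}{v_k(\xi)}\Big]\tilde N^{\mathbb P_k}(d\xi,dt),\qquad Z^\beta_{k,0}=1 .$$ $\mathfrak B$ is the set of $\beta\in\mathcal B$ such that, for all $k\in\mathcal I$, $Z^\beta_k$ exists, $\mathbb E^{\mathbb P_k}[Z^\beta_{k,T}]=1$ and $\mathbb E^{\mathbb P_k}[(Z^\beta_{k,T})^2]<\infty$. **Proposition.** Let $\beta^*(\xi)=(1+\eta)\,v_C(\xi)$. Then $\beta^*\in\mathfrak B$. Moreover, for each $k\in\mathcal I$, every solution $Z^*_k$ of the above equation with $\beta=\beta^*$ is $\mathbb P_k$-a.s. nonnegative and is a $\mathbb P_k$-martingale on $[0,T]$, with $\mathbb E^{\mathbb P_k}[Z^*_{k,T}]=1$ and $\mathbb E^{\mathbb P_k}[(Z^*_{k,T})^2]<\infty$. With $$\ell_k(t)=\exp\Big(t\int_{\mathbb R_+}\Big[1-(1+\eta)\frac{v_C(\xi)}{v_k(\xi)}\Big]^2\nu_k(d\xi)\Big),\qquad \alpha^*(t,\xi,\boldsymbol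 z)=\xi-\frac1\theta\sum_{k\in\mathcal I}\pi_k\,z_k\,\ell_k(T-t)\Big[(1+\eta)\frac{v_C(\xi)}{v_k(\xi)}-1\Big],$$ and $\boldsymbol Z^*=(Z^*_k)_{k\in\mathcal I}$, the random field $\alpha^*(t,\xi,\boldsymbol Z^*_{t^-})$ belongs to $\mathcal A$, and the two square-integrability conditions in the definition of $\mathcal A$ also hold for $\alpha^*(t,\xi,\boldsymbol Z^*_t)$. -/

import Mathlib

open MeasureTheory ProbabilityTheory Filter Topology
open scoped NNReal ENNReal

noncomputable section

namespace RiskSharing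

/-- The set of losses `ℝ₊ = (0, ∞)`. -/
abbrev marks : Set ℝ := Set.Ioi 0

/-- The measure `ν(dξ) = v(ξ) dξ` on `ℝ₊` with density `v`. -/
def compensatorMeasure (v : ℝ → ℝ) : Measure ℝ :=
  (volume.restrict marks).withDensity fun ξ => ENNReal.ofReal (v ξ)

/-- Lebesgue measure on the time interval `(0, T]`, as a measure on `ℝ≥0`. -/
def timeMeasure (T : ℝ≥0) : Measure ℝ≥0 :=
  (volume.restrict (Set.Ioc (0 : ℝ) T)).map Real.toNNReal

/-- The intensity measure `ν(dξ) dt` of a random measure on `(0, T] × ℝ₊`. -/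
def intensity (T : ℝ≥0) (ν : Measure ℝ) : Measure (ℝ≥0 × ℝ) :=
  (timeMeasure T).prod ν

/-- `N` is, under the probability measure `P` and relative to the filtration `𝓕`, a Poisson random
measure on `(0, T] × ℝ₊` with compensator `ν(dξ) dt`. -/
structure IsPoissonRandomMeasure {Ω : Type*} {mΩ : MeasurableSpace Ω}
    (𝓕 : Filtration ℝ≥0 mΩ) (P : Measure Ω) (T : ℝ≥0) (ν : Measure ℝ)
    (N : Ω → Measure (ℝ≥0 × ℝ)) : Prop where
  /-- `N` is integer valued. -/
  counting : ∀ᵐ ω ∂P, ∀ B, MeasurableSet B → ∃ m : ℕ∞, N ω B = (m : ℝ≥0∞)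
  /-- The points up to time `t` are known at time `t`. -/
  adapted : ∀ t B, MeasurableSet B → B ⊆ Set.Iic t ×ˢ Set.univ →
    Measurable[𝓕 t] fun ω => N ω B
  /-- The number of points in `B` has the Poisson law with mean the intensity of `B`. -/
  poisson : ∀ B, MeasurableSet B → intensity T ν B ≠ ∞ →
    P.map (fun ω => N ω B) =
      (poissonMeasure (intensity T ν B).toNNReal).map fun m : ℕ => (m : ℝ≥0∞)
  /-- The numbers of points in disjoint sets are independent. -/
  indep_disjoint : ∀ (m : ℕ) (B : Fin m → Set (ℝ≥0 × ℝ)), (∀ i, MeasurableSet (B i)) →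
    Pairwise (Function.onFun Disjoint B) → iIndepFun (fun i ω => N ω (B i)) P
  /-- The points after time `s` are independent of the information at time `s`. -/
  indep_past : ∀ s : ℝ≥0,
    Indep
      (⨆ (B : Set (ℝ≥0 × ℝ)) (_ : MeasurableSet B ∧ B ⊆ Set.Ioi s ×ˢ Set.univ),
        MeasurableSpace.comap (fun ω => N ω B) inferInstance)
      (𝓕 s) P

/-- `α_t(ξ)`, `t ∈ [0, T]`, `ξ ∈ ℝ₊`, is an `𝓕`-predictable random field: it is measurable for the
product of the predictable σ-algebra and the Borel σ-algebra on `[0, T] × Ω × ℝ₊`. -/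
def IsPredictableField {Ω : Type*} {mΩ : MeasurableSpace Ω} (𝓕 : Filtration ℝ≥0 mΩ) (T : ℝ≥0)
    (α : ℝ≥0 → Ω → ℝ → ℝ) : Prop :=
  Measurable[𝓕.predictable.prod (borel ℝ)]
    (Set.indicator {p : (ℝ≥0 × Ω) × ℝ | p.1.1 ≤ T ∧ p.2 ∈ marks} fun p => α p.1.1 p.1.2 p.2)

/-- `𝔼^P ∫₀ᵀ ∫ f_s(ξ)² ν(dξ) ds < ∞`. -/
def SquareIntegrableField {Ω : Type*} {mΩ : MeasurableSpace Ω} (P : Measure Ω) (T : ℝ≥0)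
    (ν : Measure ℝ) (f : ℝ≥0 → Ω → ℝ → ℝ) : Prop :=
  ∫⁻ ω, (∫⁻ s, (∫⁻ ξ, ENNReal.ofReal (f s ω ξ ^ 2) ∂ν) ∂(timeMeasure T)) ∂P < ∞

/-- The set of admissible risk sharing strategies; `P` and `v` are the probability measure and the
compensator density of the counterparty. -/
structure AdmissibleStrategy {Ω : Type*} {mΩ : MeasurableSpace Ω} (𝓕 : Filtration ℝ≥0 mΩ)
    (P : Measure Ω) (T : ℝ≥0) (v : ℝ → ℝ) (α : ℝ≥0 → Ω → ℝ → ℝ) : Prop where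
  predictable : IsPredictableField 𝓕 T α
  ceded : SquareIntegrableField P T (compensatorMeasure v) α
  retained : SquareIntegrableField P T (compensatorMeasure v) fun s ω ξ => ξ - α s ω ξ

/-- The left limit `Z_{t-}(ω)`, equal to `Z_0(ω)` at `t = 0`. -/
def leftValue {Ω : Type*} (Z : ℝ≥0 → Ω → ℝ) (t : ℝ≥0) (ω : Ω) : ℝ :=
  Function.leftLim (fun s => Z s ω) t

/-- The process `Z` is càdlàg on `[0, T]`. -/
def IsCadlag {Ω : Type*} (T : ℝ≥0) (Z : ℝ≥0 → Ω → ℝ) : Prop :=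
  ∀ ω, (∀ t < T, ContinuousWithinAt (fun s => Z s ω) (Set.Ici t) t) ∧
    ∀ t ≤ T, ∃ l, Tendsto (fun s => Z s ω) (𝓝[<] t) (𝓝 l)

/-- The integrand `Z_{s-} (1 - β_s(ξ) / v(ξ))`. -/
def auxiliaryIntegrand {Ω : Type*} (v : ℝ → ℝ) (β : ℝ≥0 → Ω → ℝ → ℝ) (Z : ℝ≥0 → Ω → ℝ) (ω : Ω)
    (p : ℝ≥0 × ℝ) : ℝ :=
  leftValue Z p.1 ω * (1 - β p.1 ω p.2 / v p.2)

/-- `Z` is an adapted càdlàg solution on `[0, T]` of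
`dZ_t = - Z_{t-} ∫ (1 - β_t(ξ) / v(ξ)) (N(dξ, dt) - v(ξ) dξ dt)`, `Z_0 = 1`.
The compensator measures are finite, so that `N` has finitely many points and the integral is a
pathwise one. -/
structure IsAuxiliaryProcess {Ω : Type*} {mΩ : MeasurableSpace Ω} (𝓕 : Filtration ℝ≥0 mΩ)
    (P : Measure Ω) (T : ℝ≥0) (v : ℝ → ℝ) (N : Ω → Measure (ℝ≥0 × ℝ))
    (β : ℝ≥0 → Ω → ℝ → ℝ) (Z : ℝ≥0 → Ω → ℝ) : Prop where
  adapted : ∀ t ≤ T, Measurable[𝓕 t] (Z t)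
  cadlag : IsCadlag T Z
  equation : ∀ᵐ ω ∂P, ∀ t ≤ T,
    IntegrableOn (auxiliaryIntegrand v β Z ω) (Set.Ioc 0 t ×ˢ marks) (N ω) ∧
    IntegrableOn (auxiliaryIntegrand v β Z ω) (Set.Ioc 0 t ×ˢ marks)
      (intensity T (compensatorMeasure v)) ∧
    Z t ω = 1 -
      (∫ p in Set.Ioc 0 t ×ˢ marks, auxiliaryIntegrand v β Z ω p ∂(N ω) -
        ∫ p in Set.Ioc 0 t ×ˢ marks, auxiliaryIntegrand v β Z ω p
          ∂(intensity T (compensatorMeasure v)))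

/-- The set of nonnegative predictable random fields `β` with
`𝔼^{P_k} ∫₀ᵀ ∫ (1 - β_s(ξ) / v_k(ξ))² ν_k(dξ) ds < ∞` for all `k`. -/
structure IsCompensator {Ω : Type*} {mΩ : MeasurableSpace Ω} {ι : Type*} (𝓕 : Filtration ℝ≥0 mΩ)
    (P : ι → Measure Ω) (T : ℝ≥0) (v : ι → ℝ → ℝ) (β : ℝ≥0 → Ω → ℝ → ℝ) : Prop where
  predictable : IsPredictableField 𝓕 T β
  nonneg : ∀ t ≤ T, ∀ ω, ∀ ξ ∈ marks, 0 ≤ β t ω ξ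
  squareIntegrable : ∀ k, SquareIntegrableField (P k) T (compensatorMeasure (v k))
    fun s ω ξ => 1 - β s ω ξ / v k ξ

/-- The set of admissible compensators: for every `k` the auxiliary process `Z_k` exists,
`𝔼^{P_k}[Z_{k,T}] = 1` and `𝔼^{P_k}[Z_{k,T}²] < ∞`. -/
structure AdmissibleCompensator {Ω : Type*} {mΩ : MeasurableSpace Ω} {ι : Type*}
    (𝓕 : Filtration ℝ≥0 mΩ) (P : ι → Measure Ω) (T : ℝ≥0) (v : ι → ℝ → ℝ)
    (N : Ω → Measure (ℝ≥0 × ℝ)) (β : ℝ≥0 → Ω → ℝ → ℝ) : Prop where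
  isCompensator : IsCompensator 𝓕 P T v β
  density : ∀ k, ∃ Z, IsAuxiliaryProcess 𝓕 (P k) T (v k) N β Z ∧
    ∫ ω, Z T ω ∂(P k) = 1 ∧ MemLp (Z T) 2 (P k)

/-- `ℓ(t) = exp (t ∫ (1 - (1 + η) v_C(ξ) / v_k(ξ))² ν_k(dξ))`, with `vC = v_C` and `vk = v_k`. -/
def ell (η : ℝ) (vC vk : ℝ → ℝ) (t : ℝ) : ℝ :=
  Real.exp (t * ∫ ξ, (1 - (1 + η) * (vC ξ / vk ξ)) ^ 2 ∂(compensatorMeasure vk))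

/-- The candidate risk sharing strategy in feedback form, `α*(t, ξ, z)`. -/
def alphaStar {ι : Type*} [Fintype ι] (C : ι) (T : ℝ≥0) (v : ι → ℝ → ℝ) (θ η : ℝ) (π : ι → ℝ)
    (t : ℝ≥0) (ξ : ℝ) (z : ι → ℝ) : ℝ :=
  ξ - 1 / θ * ∑ k, π k * z k * ell η (v C) (v k) ((T : ℝ) - t) *
    ((1 + η) * (v C ξ / v k ξ) - 1)

/-- The candidate compensator `β*(ξ) = (1 + η) v_C(ξ)`, a deterministic field constant in time. -/
def betaStar {Ω : Type*} (vC : ℝ → ℝ) (η : ℝ) : ℝ≥0 → Ω → ℝ → ℝ :=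
  fun _ _ ξ => (1 + η) * vC ξ

end RiskSharing

end

noncomputable section

namespace RiskSharing

/-! ### Integer valued measures as finite sums of point masses -/

/-! For the candidate compensator the ratio g = (1 + η) v_C / v_k depends on the mark alone. Since
ν_k is finite, almost every path of N is a finite sum of point masses (s, x_s) at distinct times
(`exists_eq_sum_dirac`, `ae_simple`). The equation for Z is then a pathwise linear equation with
finitely many jumps, and it is solved explicitly by Z_t = e^{ct} ∏_{s ≤ t} g(x_s) with c = ∫ (1 - g)
dν_k (`jumpExp_eq`, `exists_isAuxiliaryProcess`). A Gronwall-type argument that tolerates atoms in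
time (`eq_zero_of_abs_le_setIntegral`) shows that every solution agrees with this one almost surely,
so all claims can be read off the formula.

Positivity of the factors g(x_s) comes from equivalence of the measures: N has no points where v_C ≤
0 under P_C, hence none under P_k, hence ν_k does not charge that set
(`compensatorMeasure_compl_positiveMarks`).

Moments rest on the exponential formula 𝔼 exp(∫ h dN) = exp(∫ (e^h - 1) dμ)
(`lintegral_exp_pointSum`). Applied to log g on (s, t], it shows that the growth factor Z_t / Z_s
has mean one; this factor is independent of the past, which gives the martingale property. Applied
to 2 max(log g, 0), it bounds the second moment of a variable `jumpBound` that dominates |Z_t| for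
all t ≤ T.

The admissibility of the strategy needs the same second moment under P_C, where N has compensator
ν_C; it is finite because ∫ v_C³ / v_k² is. The predictability of the strategy is that of left
limits of adapted processes. -/

lemma exists_eq_sum_dirac_aux (n : ℕ) : ∀ M : Measure (ℝ≥0 × ℝ),
    M Set.univ ≤ n → (∀ B, MeasurableSet B → ∃ m : ℕ∞, M B = (m : ℝ≥0∞)) →
    (∀ s : ℝ≥0, M ({s} ×ˢ Set.univ) ≤ 1) →
    ∃ (S : Finset ℝ≥0) (x : ℝ≥0 → ℝ), M = ∑ s ∈ S, Measure.dirac (s, x s) := by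
  induction n with
  | zero =>
    intro M hM _ _
    refine ⟨∅, fun _ => 0, ?_⟩
    simpa using hM
  | succ n ih =>
    intro M hM hc hs
    by_cases h0 : M = 0
    · exact ⟨∅, fun _ => 0, by simpa using h0⟩
    have hfin : IsFiniteMeasure M := ⟨hM.trans_lt (ENNReal.natCast_lt_top _)⟩
    have hge : ∀ B, MeasurableSet B → M B ≠ 0 → 1 ≤ M B := by
      intro B hB hne
      obtain ⟨m, hm⟩ := hc B hB
      rw [hm] at hne ⊢
      have : m ≠ 0 := by rintro rfl; simp at hne
      exact_mod_cast Order.one_le_iff_ne_zero.mpr this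
    -- Without an atom, small closed balls have mass below one, hence zero by integrality, so the
    -- measure is locally null and therefore null.
    obtain ⟨p, hp⟩ : ∃ p, M {p} ≠ 0 := by
      by_contra! hall
      refine h0 (Measure.measure_univ_eq_zero.mp ?_)
      refine measure_null_of_locally_null _ fun p _ => ?_
      have ht : Tendsto (fun r : ℝ => M (Metric.closedBall p r)) (𝓝[>] 0) (𝓝 (M {p})) := by
        have := tendsto_measure_biInter_gt (μ := M) (s := fun r : ℝ => Metric.closedBall p r)
          (a := 0) (fun r _ => Metric.isClosed_closedBall.measurableSet.nullMeasurableSet)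
          (fun i j _ hij => Metric.closedBall_subset_closedBall hij) ⟨1, one_pos, measure_ne_top _ _⟩
        have hinter : (⋂ r > (0 : ℝ), Metric.closedBall p r) = {p} := ?_
        · rwa [hinter] at this
        symm
        ext q
        simp only [Set.mem_singleton_iff, Set.mem_iInter, Metric.mem_closedBall]
        refine ⟨fun h r hr => by rw [h, dist_self]; exact hr.le, fun h => ?_⟩
        exact dist_le_zero.mp (le_of_forall_gt_imp_ge_of_dense h)
      rw [hall p] at ht
      have h1 := ht.eventually (gt_mem_nhds (zero_lt_one (α := ℝ≥0∞)))
      obtain ⟨r, hr1, hr0⟩ := (h1.and self_mem_nhdsWithin).exists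
      refine ⟨Metric.closedBall p r, mem_nhdsWithin_of_mem_nhds
        (Metric.closedBall_mem_nhds p hr0), ?_⟩
      by_contra hne
      exact absurd (hge _ Metric.isClosed_closedBall.measurableSet hne) (not_le.mpr hr1)
    have hp1 : 1 ≤ M {p} := hge _ (measurableSet_singleton p) hp
    -- The whole time slice through the atom is removed, not just the atom: as its mass is at most
    -- one, the slice contains nothing else, and the time of the atom cannot recur in the remainder.
    set A : Set (ℝ≥0 × ℝ) := {p.1} ×ˢ Set.univ with hA
    have hAm : MeasurableSet A := (measurableSet_singleton _).prod MeasurableSet.univ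
    have hpA : {p} ⊆ A := by rintro q rfl; simp [hA]
    have hA1 : M A = 1 := le_antisymm (hs _) (hp1.trans (measure_mono hpA))
    have hdir : M.restrict A = Measure.dirac p := by
      have hpe : M {p} = 1 := le_antisymm ((measure_mono hpA).trans hA1.le) hp1
      have hcompl : M (A \ {p}) = 0 := by
        rw [measure_sdiff hpA (measurableSet_singleton p).nullMeasurableSet (measure_ne_top _ _),
          hA1, hpe, tsub_self]
      ext B hB
      rw [Measure.restrict_apply hB, Measure.dirac_apply' _ hB]
      by_cases hpB : p ∈ B
      · rw [Set.indicator_of_mem hpB, Pi.one_apply]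
        refine le_antisymm ((measure_mono Set.inter_subset_right).trans hA1.le) ?_
        rw [← hpe]
        exact measure_mono (by rintro q rfl; exact ⟨hpB, hpA rfl⟩)
      · rw [Set.indicator_of_notMem hpB]
        refine measure_mono_null ?_ hcompl
        rintro q ⟨hq, hqA⟩
        refine ⟨hqA, ?_⟩
        rintro rfl
        exact hpB hq
    have hsum : M = M.restrict Aᶜ + Measure.dirac p := by
      rw [← hdir, add_comm, Measure.restrict_add_restrict_compl hAm]
    obtain ⟨S, x, hSx⟩ := ih (M.restrict Aᶜ) (by
        have h1 : M Set.univ = M.restrict Aᶜ Set.univ + 1 := by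
          conv_lhs => rw [hsum]
          simp
        rw [h1] at hM
        push_cast at hM
        exact (ENNReal.add_le_add_iff_right ENNReal.one_ne_top).mp hM)
      (fun B hB => by
        rw [Measure.restrict_apply hB]
        exact hc _ (hB.inter hAm.compl))
      (fun s => (Measure.restrict_apply_le _ _).trans (hs s))
    have hpS : p.1 ∉ S := by
      intro hmem
      have h1 : M.restrict Aᶜ A = 0 := by
        rw [Measure.restrict_apply hAm]; simp
      rw [hSx, Measure.finsetSum_apply, Finset.sum_eq_zero_iff] at h1
      have := h1 _ hmem
      rw [Measure.dirac_apply' _ hAm] at this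
      simp [hA] at this
    refine ⟨insert p.1 S, Function.update x p.1 p.2, ?_⟩
    rw [Finset.sum_insert hpS, Function.update_self]
    conv_lhs => rw [hsum, hSx, add_comm]
    congr 1
    refine Finset.sum_congr rfl fun s hs' => ?_
    rw [Function.update_of_ne]
    rintro rfl
    exact hpS hs'

/-- A finite integer valued measure on `ℝ≥0 × ℝ` without simultaneous points is a finite sum of
point masses at distinct times. -/
lemma exists_eq_sum_dirac (M : Measure (ℝ≥0 × ℝ)) (hM : M Set.univ ≠ ∞)
    (hc : ∀ B, MeasurableSet B → ∃ m : ℕ∞, M B = (m : ℝ≥0∞))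
    (hs : ∀ s : ℝ≥0, M ({s} ×ˢ Set.univ) ≤ 1) :
    ∃ (S : Finset ℝ≥0) (x : ℝ≥0 → ℝ), M = ∑ s ∈ S, Measure.dirac (s, x s) := by
  obtain ⟨n, hn⟩ := ENNReal.exists_nat_gt hM
  exact exists_eq_sum_dirac_aux n M hn.le hc hs

/-! ### Exponentials with finitely many multiplicative jumps -/

/-- The function `t ↦ e^{ct} ∏_{s ≤ t} a_s`, the product being over the jump times `s ∈ S`. -/
def jumpExp (c : ℝ) (S : Finset ℝ≥0) (a : ℝ≥0 → ℝ) (t : ℝ≥0) : ℝ :=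
  Real.exp (c * t) * ∏ s ∈ S, if s ≤ t then a s else 1

/-- The left limits `t ↦ e^{ct} ∏_{s < t} a_s` of `jumpExp`. -/
def jumpExpLeft (c : ℝ) (S : Finset ℝ≥0) (a : ℝ≥0 → ℝ) (t : ℝ≥0) : ℝ :=
  Real.exp (c * t) * ∏ s ∈ S, if s < t then a s else 1

lemma continuousWithinAt_jumpExp (c : ℝ) (S : Finset ℝ≥0) (a : ℝ≥0 → ℝ) (t : ℝ≥0) :
    ContinuousWithinAt (jumpExp c S a) (Set.Ici t) t := by
  refine ContinuousWithinAt.mul (by fun_prop) ?_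
  refine tendsto_finsetProd _ fun s _ => ?_
  refine tendsto_const_nhds.congr' ?_
  by_cases hst : s ≤ t
  · filter_upwards [self_mem_nhdsWithin] with u hu
    rw [if_pos hst, if_pos (hst.trans hu)]
  · filter_upwards [mem_nhdsWithin_of_mem_nhds (gt_mem_nhds (not_le.mp hst))] with u hu
    rw [if_neg hst, if_neg (not_le.mpr hu)]

lemma tendsto_jumpExp_left (c : ℝ) (S : Finset ℝ≥0) (a : ℝ≥0 → ℝ) (t : ℝ≥0) :
    Tendsto (jumpExp c S a) (𝓝[<] t) (𝓝 (jumpExpLeft c S a t)) := by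
  refine Tendsto.mul ?_ (tendsto_finsetProd _ fun s _ => ?_)
  · have : ContinuousAt (fun u : ℝ≥0 => Real.exp (c * u)) t := by fun_prop
    exact this.tendsto.mono_left nhdsWithin_le_nhds
  · refine tendsto_const_nhds.congr' ?_
    by_cases hst : s < t
    · filter_upwards [mem_nhdsWithin_of_mem_nhds (lt_mem_nhds hst)] with u hu
      rw [if_pos hst, if_pos hu.le]
    · filter_upwards [self_mem_nhdsWithin] with u hu
      rw [if_neg hst, if_neg (not_le.mpr (lt_of_lt_of_le hu (not_lt.mp hst)))]

lemma nhdsLT_zero_eq_bot : 𝓝[<] (0 : ℝ≥0) = ⊥ := by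
  have : Set.Iio (0 : ℝ≥0) = ∅ := by ext x; simp
  rw [this, nhdsWithin_empty]

lemma nhdsLT_neBot {t : ℝ≥0} (ht : 0 < t) : (𝓝[<] t).NeBot :=
  nhdsLT_neBot_of_exists_lt ⟨0, ht⟩

/-- At time 0 the left limit is by convention the value itself; the two products agree there only
because no jump sits at 0. -/
lemma leftLim_jumpExp (c : ℝ) {S : Finset ℝ≥0} (hS : ∀ s ∈ S, 0 < s) (a : ℝ≥0 → ℝ) (t : ℝ≥0) :
    Function.leftLim (jumpExp c S a) t = jumpExpLeft c S a t := by
  rcases eq_or_ne t 0 with rfl | ht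
  · rw [leftLim_eq_of_eq_bot _ nhdsLT_zero_eq_bot, jumpExp, jumpExpLeft]
    congr 1
    refine Finset.prod_congr rfl fun s hs => ?_
    rw [if_neg (not_le.mpr (hS s hs)), if_neg (not_lt.mpr zero_le)]
  · have := nhdsLT_neBot (pos_iff_ne_zero.mpr ht)
    exact leftLim_eq_of_tendsto (tendsto_jumpExp_left c S a t)

lemma measurable_jumpExpLeft (c : ℝ) (S : Finset ℝ≥0) (a : ℝ≥0 → ℝ) :
    Measurable (jumpExpLeft c S a) := by
  refine Measurable.mul (by fun_prop) (Finset.measurable_fun_prod _ fun s _ => ?_)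
  exact Measurable.ite measurableSet_Ioi measurable_const measurable_const

lemma abs_prod_ite_le (S : Finset ℝ≥0) (a : ℝ≥0 → ℝ) (p : ℝ≥0 → Prop) [DecidablePred p] :
    |∏ s ∈ S, if p s then a s else 1| ≤ ∏ s ∈ S, max |a s| 1 := by
  rw [Finset.abs_prod]
  refine Finset.prod_le_prod (fun _ _ => abs_nonneg _) fun s _ => ?_
  split_ifs
  · exact le_max_left _ _
  · simp

lemma exp_mul_le_exp_abs_mul (c : ℝ) {t T : ℝ≥0} (h : t ≤ T) :
    Real.exp (c * t) ≤ Real.exp (|c| * T) := by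
  refine Real.exp_le_exp.mpr ?_
  calc c * t ≤ |c| * t := mul_le_mul_of_nonneg_right (le_abs_self c) t.2
    _ ≤ |c| * T := mul_le_mul_of_nonneg_left (by exact_mod_cast h) (abs_nonneg c)

lemma abs_jumpExp_le (c : ℝ) (S : Finset ℝ≥0) (a : ℝ≥0 → ℝ) {t T : ℝ≥0} (h : t ≤ T) :
    |jumpExp c S a t| ≤ Real.exp (|c| * T) * ∏ s ∈ S, max |a s| 1 := by
  rw [jumpExp, abs_mul, Real.abs_exp]
  exact mul_le_mul (exp_mul_le_exp_abs_mul c h) (abs_prod_ite_le S a _) (abs_nonneg _)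
    (Real.exp_pos _).le

lemma abs_jumpExpLeft_le (c : ℝ) (S : Finset ℝ≥0) (a : ℝ≥0 → ℝ) {t T : ℝ≥0} (h : t ≤ T) :
    |jumpExpLeft c S a t| ≤ Real.exp (|c| * T) * ∏ s ∈ S, max |a s| 1 := by
  rw [jumpExpLeft, abs_mul, Real.abs_exp]
  exact mul_le_mul (exp_mul_le_exp_abs_mul c h) (abs_prod_ite_le S a _) (abs_nonneg _)
    (Real.exp_pos _).le

lemma intervalIntegrable_jumpExpLeft (c : ℝ) (S : Finset ℝ≥0) (a : ℝ≥0 → ℝ) (x y : ℝ) :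
    IntervalIntegrable (fun u : ℝ => jumpExpLeft c S a u.toNNReal) volume x y := by
  rw [intervalIntegrable_iff]
  refine Measure.integrableOn_of_bounded
    (M := Real.exp (|c| * (max x y).toNNReal) * ∏ s ∈ S, max |a s| 1) (by simp)
    ((measurable_jumpExpLeft c S a).comp measurable_real_toNNReal).aestronglyMeasurable ?_
  filter_upwards [ae_restrict_mem measurableSet_uIoc] with u hu
  exact abs_jumpExpLeft_le c S a (Real.toNNReal_le_toNNReal hu.2)

/-- Induction on the jump times, adding the latest one m. Up to m the left limits are unchanged;
after m they equal a constant times e^{cu}, whose integral is explicit. The identity at t ≥ m then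
follows from the induction hypothesis at time m. -/
lemma jumpExp_eq (c : ℝ) (S : Finset ℝ≥0) (hS : ∀ s ∈ S, 0 < s) (a : ℝ≥0 → ℝ) :
    ∀ t : ℝ≥0, jumpExp c S a t = 1 - ((∑ s ∈ S, if s ≤ t then jumpExpLeft c S a s * (1 - a s) else 0)
      - c * ∫ u in (0 : ℝ)..t, jumpExpLeft c S a u.toNNReal) := by
  have hexp : ∀ (C x y : ℝ), c * ∫ u in x..y, Real.exp (c * u) * C =
      (Real.exp (c * y) - Real.exp (c * x)) * C := by
    intro C x y
    rw [intervalIntegral.integral_mul_const, ← mul_assoc]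
    congr 1
    rcases eq_or_ne c 0 with rfl | hc
    · simp
    · rw [intervalIntegral.integral_comp_mul_left _ hc, integral_exp, smul_eq_mul,
        mul_inv_cancel_left₀ hc]
  induction S using Finset.induction_on_max with
  | empty =>
    intro t
    have : ∀ u ∈ Set.uIcc (0 : ℝ) t, jumpExpLeft c ∅ a u.toNNReal = Real.exp (c * u) * 1 := by
      intro u hu
      rw [Set.uIcc_of_le t.coe_nonneg] at hu
      simp [jumpExpLeft, Real.coe_toNNReal _ hu.1]
    rw [intervalIntegral.integral_congr this, hexp]
    simp [jumpExp]
  | insert m S hm ih =>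
    intro t
    have hmS : m ∉ S := fun h => lt_irrefl _ (hm m h)
    have hS' : ∀ s ∈ S, 0 < s := fun s hs => hS s (Finset.mem_insert_of_mem hs)
    have hle : ∀ u ≤ m, jumpExpLeft c (insert m S) a u = jumpExpLeft c S a u := by
      intro u hu
      rw [jumpExpLeft, Finset.prod_insert hmS, if_neg (not_lt.mpr hu), one_mul, jumpExpLeft]
    have hsum : (∑ s ∈ insert m S, if s ≤ t then jumpExpLeft c (insert m S) a s * (1 - a s) else 0)
        = (if m ≤ t then jumpExpLeft c S a m * (1 - a m) else 0) +
          ∑ s ∈ S, if s ≤ t then jumpExpLeft c S a s * (1 - a s) else 0 := by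
      rw [Finset.sum_insert hmS, hle m le_rfl]
      congr 1
      exact Finset.sum_congr rfl fun s hs => by rw [hle s (hm s hs).le]
    have hint : ∀ r ≤ m, ∫ u in (0 : ℝ)..r, jumpExpLeft c (insert m S) a u.toNNReal
        = ∫ u in (0 : ℝ)..r, jumpExpLeft c S a u.toNNReal := by
      intro r hr
      refine intervalIntegral.integral_congr fun u hu => ?_
      rw [Set.uIcc_of_le r.coe_nonneg] at hu
      exact hle _ ((Real.toNNReal_le_iff_le_coe.mpr hu.2).trans hr)
    rw [hsum]
    rcases lt_or_ge t m with htm | hmt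
    · rw [if_neg (not_le.mpr htm), zero_add, hint t htm.le, ← ih hS' t, jumpExp, jumpExp,
        Finset.prod_insert hmS, if_neg (not_le.mpr htm), one_mul]
    · have hprod : ∀ u, m ≤ u → (∏ s ∈ S, if s < u then a s else 1) = ∏ s ∈ S, a s :=
        fun u hu => Finset.prod_congr rfl fun s hs => if_pos ((hm s hs).trans_le hu)
      have hprod' : ∀ u, m ≤ u → (∏ s ∈ S, if s ≤ u then a s else 1) = ∏ s ∈ S, a s :=
        fun u hu => Finset.prod_congr rfl fun s hs => if_pos ((hm s hs).le.trans hu)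
      have hsum' : (∑ s ∈ S, if s ≤ t then jumpExpLeft c S a s * (1 - a s) else 0) =
          ∑ s ∈ S, if s ≤ m then jumpExpLeft c S a s * (1 - a s) else 0 :=
        Finset.sum_congr rfl fun s hs => by
          rw [if_pos (hm s hs).le, if_pos ((hm s hs).le.trans hmt)]
      have htail : c * ∫ u in (m : ℝ)..t, jumpExpLeft c (insert m S) a u.toNNReal
          = (Real.exp (c * t) - Real.exp (c * m)) * (a m * ∏ s ∈ S, a s) := by
        rw [← hexp]
        congr 1
        -- The half-open interval matters: at u = m itself the left limit does not yet carry the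
        -- factor a_m.
        refine intervalIntegral.integral_congr_ae (ae_of_all _ fun u hu => ?_)
        rw [Set.uIoc_of_le (by exact_mod_cast hmt)] at hu
        have h1 : m < u.toNNReal := Real.lt_toNNReal_iff_coe_lt.mpr hu.1
        rw [jumpExpLeft, Finset.prod_insert hmS, if_pos h1, hprod _ h1.le,
          Real.coe_toNNReal _ (m.2.trans hu.1.le)]
      have ihm := ih hS' m
      rw [jumpExp, hprod' m le_rfl] at ihm
      rw [← intervalIntegral.integral_add_adjacent_intervals
        (intervalIntegrable_jumpExpLeft c _ a 0 m) (intervalIntegrable_jumpExpLeft c _ a m t),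
        mul_add, htail, hint m le_rfl, hsum', if_pos hmt, jumpExp, Finset.prod_insert hmS,
        if_pos hmt, hprod' t hmt, jumpExpLeft, hprod m le_rfl]
      linear_combination ihm

/-! ### A uniqueness principle for linear integral equations -/

lemma tendsto_div_add_one_nnreal (a : ℝ≥0) :
    Tendsto (fun n : ℕ => a / ((n : ℝ≥0) + 1)) atTop (𝓝 0) := by
  refine NNReal.tendsto_coe.mp ?_
  have h : Tendsto (fun n : ℕ => (a : ℝ) / ((n : ℝ) + 1)) atTop (𝓝 0) :=
    tendsto_const_nhds.div_atTop (tendsto_atTop_add_const_right _ _ tendsto_natCast_atTop_atTop)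
  simpa using h

/-- Gronwall's argument for a measure that may have atoms in time. Let τ be the supremum of the
times up to which D vanishes. If τ < T, then on a short interval (τ, r] where |f| has integral at
most 1/2, any bound on |D| can be halved repeatedly, so D vanishes up to r, a contradiction. -/
lemma eq_zero_of_abs_le_setIntegral (M : Measure (ℝ≥0 × ℝ)) (E : Set ℝ) (hE : MeasurableSet E)
    (f : ℝ → ℝ) (hf : Integrable (fun p : ℝ≥0 × ℝ => f p.2) M) (T : ℝ≥0)
    (D : ℝ≥0 → ℝ) (hlim : ∀ t ≤ T, ∃ l, Tendsto D (𝓝[<] t) (𝓝 l))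
    (hint : IntegrableOn (fun p : ℝ≥0 × ℝ => Function.leftLim D p.1 * f p.2) (Set.Ioc 0 T ×ˢ E) M)
    (hD : ∀ t ≤ T, |D t| ≤ ∫ p in Set.Ioc 0 t ×ˢ E, |Function.leftLim D p.1 * f p.2| ∂M) :
    ∀ t ≤ T, D t = 0 := by
  have hm : ∀ a b : ℝ≥0, MeasurableSet (Set.Ioc a b ×ˢ E) := fun a b => measurableSet_Ioc.prod hE
  have hleft : ∀ K : ℝ, ∀ s, 0 < s → s ≤ T → (∀ u < s, |D u| ≤ K) → |Function.leftLim D s| ≤ K := by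
    intro K s hs hsT hK
    have := nhdsLT_neBot hs
    obtain ⟨l, hl⟩ := hlim s hsT
    rw [leftLim_eq_of_tendsto hl]
    exact le_of_tendsto hl.abs (eventually_of_mem self_mem_nhdsWithin fun u hu => hK u hu)
  have hmono : ∀ a r, r ≤ T → IntegrableOn (fun p : ℝ≥0 × ℝ => |Function.leftLim D p.1 * f p.2|)
      (Set.Ioc a r ×ˢ E) M := fun a r hr =>
    IntegrableOn.mono_set hint.abs (Set.prod_mono (Set.Ioc_subset_Ioc zero_le hr) le_rfl)
  set G : Set ℝ≥0 := {t | t ≤ T ∧ ∀ u ≤ t, D u = 0} with hG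
  have hG0 : (0 : ℝ≥0) ∈ G := by
    refine ⟨zero_le, fun u hu => ?_⟩
    obtain rfl : u = 0 := le_antisymm hu zero_le
    simpa using hD 0 zero_le
  have hGbdd : BddAbove G := ⟨T, fun t ht => ht.1⟩
  set τ := sSup G with hτ
  have hτT : τ ≤ T := csSup_le ⟨0, hG0⟩ fun t ht => ht.1
  have hlt : ∀ u < τ, D u = 0 := by
    intro u hu
    obtain ⟨t, ht, hut⟩ := exists_lt_of_lt_csSup ⟨0, hG0⟩ hu
    exact ht.2 u hut.le
  have hleft0 : ∀ s, 0 < s → s ≤ τ → Function.leftLim D s = 0 := by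
    intro s hs hsτ
    refine abs_nonpos_iff.mp (hleft 0 s hs (hsτ.trans hτT) fun u hu => ?_)
    rw [hlt u (hu.trans_le hsτ), abs_zero]
  have hzero : ∀ u ≤ τ, ∫ p in Set.Ioc 0 u ×ˢ E, |Function.leftLim D p.1 * f p.2| ∂M = 0 :=
    fun u hu => setIntegral_eq_zero_of_forall_eq_zero fun p hp => by
      rw [hleft0 p.1 hp.1.1 (hp.1.2.trans hu), zero_mul, abs_zero]
  -- The right-hand side sees D only through left limits, so vanishing before τ extends to τ even if
  -- M has an atom there.
  have hle : ∀ u ≤ τ, D u = 0 := fun u hu =>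
    abs_nonpos_iff.mp ((hD u (hu.trans hτT)).trans_eq (hzero u hu))
  rcases hτT.eq_or_lt with heq | hτlt
  · intro t ht
    exact hle t (heq ▸ ht)
  exfalso
  -- The intervals (τ, τ + δ] shrink to the empty set as δ decreases to 0, so the integral tends to
  -- 0 whatever atoms M has.
  obtain ⟨r, hτr, hrT, hr⟩ : ∃ r, τ < r ∧ r ≤ T ∧ ∫ p in Set.Ioc τ r ×ˢ E, |f p.2| ∂M ≤ 1 / 2 := by
    have ht := tendsto_setIntegral_of_antitone (μ := M)
      (s := fun n : ℕ => Set.Ioc τ (τ + (T - τ) / (n + 1)) ×ˢ E) (f := fun p => |f p.2|)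
      (fun n => hm _ _)
      (fun i j hij => Set.prod_mono (Set.Ioc_subset_Ioc_right (by gcongr)) le_rfl)
      ⟨0, hf.abs.integrableOn⟩
    have hlim0 : Tendsto (fun n : ℕ => τ + (T - τ) / ((n : ℝ≥0) + 1)) atTop (𝓝 τ) := by
      have := tendsto_div_add_one_nnreal (T - τ)
      simpa using this.const_add τ
    have hemp : (⋂ n : ℕ, Set.Ioc τ (τ + (T - τ) / ((n : ℝ≥0) + 1)) ×ˢ E) = ∅ := by
      refine Set.eq_empty_iff_forall_notMem.mpr fun q hq => ?_
      rw [Set.mem_iInter] at hq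
      exact absurd (ge_of_tendsto' hlim0 fun n => (hq n).1.2) (not_le.mpr (hq 0).1.1)
    rw [hemp, setIntegral_empty] at ht
    obtain ⟨n, hn⟩ := (ht.eventually (gt_mem_nhds (show (0 : ℝ) < 1 / 2 by norm_num))).exists
    have hpos : 0 < T - τ := tsub_pos_of_lt hτlt
    refine ⟨τ + (T - τ) / ((n : ℝ≥0) + 1), lt_add_of_pos_right _ (by positivity), ?_, hn.le⟩
    calc τ + (T - τ) / ((n : ℝ≥0) + 1) ≤ τ + (T - τ) := by
          gcongr
          exact div_le_self zero_le (by simp)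
      _ = T := add_tsub_cancel_of_le hτlt.le
  -- The starting bound for the iteration: D is not assumed bounded, but the hypothesis bounds it by
  -- this finite integral.
  set K := ∫ p in Set.Ioc 0 T ×ˢ E, |Function.leftLim D p.1 * f p.2| ∂M with hKdef
  have hK0 : 0 ≤ K := integral_nonneg fun _ => abs_nonneg _
  have hiter : ∀ n : ℕ, ∀ t ≤ r, |D t| ≤ K / 2 ^ n := by
    intro n
    induction n with
    | zero =>
      intro t ht
      rw [pow_zero, div_one]
      refine (hD t (ht.trans hrT)).trans ?_
      exact setIntegral_mono_set hint.abs (ae_of_all _ fun _ => abs_nonneg _)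
        (Set.prod_mono (Set.Ioc_subset_Ioc_right (ht.trans hrT)) le_rfl).eventuallyLE
    | succ n ih =>
      intro t ht
      rcases le_or_gt t τ with htτ | htτ
      · rw [hle t htτ, abs_zero]; positivity
      refine (hD t (ht.trans hrT)).trans ?_
      have hsplit : Set.Ioc 0 t ×ˢ E = Set.Ioc 0 τ ×ˢ E ∪ Set.Ioc τ t ×ˢ E := by
        rw [← Set.union_prod, Set.Ioc_union_Ioc_eq_Ioc zero_le htτ.le]
      rw [hsplit, setIntegral_union (Set.disjoint_left.mpr fun p h1 h2 =>
        absurd h1.1.2 (not_le.mpr h2.1.1)) (hm _ _) (hmono _ τ hτT) (hmono _ t (ht.trans hrT)),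
        hzero τ le_rfl, zero_add]
      calc ∫ p in Set.Ioc τ t ×ˢ E, |Function.leftLim D p.1 * f p.2| ∂M
          ≤ ∫ p in Set.Ioc τ t ×ˢ E, K / 2 ^ n * |f p.2| ∂M := by
            refine setIntegral_mono_on (hmono _ t (ht.trans hrT))
              (hf.abs.integrableOn.const_mul _) (hm _ _) fun p hp => ?_
            rw [abs_mul]
            refine mul_le_mul_of_nonneg_right ?_ (abs_nonneg _)
            exact hleft _ p.1 (zero_le.trans_lt hp.1.1) (hp.1.2.trans (ht.trans hrT))
              fun u hu => ih u (hu.le.trans (hp.1.2.trans ht))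
        _ = K / 2 ^ n * ∫ p in Set.Ioc τ t ×ˢ E, |f p.2| ∂M := integral_const_mul _ _
        _ ≤ K / 2 ^ n * (1 / 2) := by
            refine mul_le_mul_of_nonneg_left (le_trans ?_ hr) (by positivity)
            exact setIntegral_mono_set hf.abs.integrableOn (ae_of_all _ fun _ => abs_nonneg _)
              (Set.prod_mono (Set.Ioc_subset_Ioc_right ht) le_rfl).eventuallyLE
        _ = K / 2 ^ (n + 1) := by ring
  have hrG : r ∈ G := by
    refine ⟨hrT, fun u hu => abs_nonpos_iff.mp ?_⟩
    have : Tendsto (fun n : ℕ => K / 2 ^ n) atTop (𝓝 0) :=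
      tendsto_const_nhds.div_atTop (tendsto_pow_atTop_atTop_of_one_lt one_lt_two)
    exact ge_of_tendsto' this fun n => hiter n u hu
  exact absurd (le_csSup hGbdd hrG) (not_le.mpr hτr)

/-! ### The time measure and the intensity measure -/

instance isFiniteMeasure_timeMeasure (T : ℝ≥0) : IsFiniteMeasure (timeMeasure T) := by
  unfold timeMeasure; infer_instance

instance isFiniteMeasure_intensity (T : ℝ≥0) (ν : Measure ℝ) [IsFiniteMeasure ν] :
    IsFiniteMeasure (intensity T ν) := by
  unfold intensity; infer_instance

lemma preimage_toNNReal_Ioc (a b : ℝ≥0) :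
    Real.toNNReal ⁻¹' Set.Ioc a b = Set.Ioc (a : ℝ) b := by
  ext x
  simp only [Set.mem_preimage, Set.mem_Ioc, Real.lt_toNNReal_iff_coe_lt,
    Real.toNNReal_le_iff_le_coe]

lemma timeMeasure_Ioc {T a b : ℝ≥0} (hb : b ≤ T) :
    timeMeasure T (Set.Ioc a b) = ENNReal.ofReal (b - a) := by
  rw [timeMeasure, Measure.map_apply measurable_real_toNNReal measurableSet_Ioc,
    preimage_toNNReal_Ioc, Measure.restrict_apply measurableSet_Ioc,
    Set.inter_eq_left.mpr (Set.Ioc_subset_Ioc (by simp) (by exact_mod_cast hb)), Real.volume_Ioc]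

lemma ae_timeMeasure_mem (T : ℝ≥0) : ∀ᵐ s ∂(timeMeasure T), s ∈ Set.Ioc 0 T := by
  refine (ae_map_iff measurable_real_toNNReal.aemeasurable measurableSet_Ioc).mpr ?_
  filter_upwards [ae_restrict_mem measurableSet_Ioc] with x hx
  exact ⟨Real.toNNReal_pos.mpr hx.1, Real.toNNReal_le_iff_le_coe.mpr hx.2⟩

lemma intensity_Ioc_prod {T a b : ℝ≥0} (hb : b ≤ T) (ν : Measure ℝ) [IsFiniteMeasure ν]
    (B : Set ℝ) :
    intensity T ν (Set.Ioc a b ×ˢ B) = ENNReal.ofReal (b - a) * ν B := by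
  rw [intensity, Measure.prod_prod, timeMeasure_Ioc hb]

/-! ### The Poisson law -/

lemma lintegral_poissonMeasure (r : ℝ≥0) (f : ℕ → ℝ≥0∞) :
    ∫⁻ n, f n ∂(poissonMeasure r) =
      ∑' n : ℕ, ENNReal.ofReal (Real.exp (-r) * r ^ n / n.factorial) * f n := by
  rw [poissonMeasure, lintegral_sum_measure]
  simp

lemma lintegral_exp_poissonMeasure (r : ℝ≥0) (y : ℝ) :
    ∫⁻ n, ENNReal.ofReal (Real.exp (y * n)) ∂(poissonMeasure r) =
      ENNReal.ofReal (Real.exp (r * (Real.exp y - 1))) := by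
  rw [lintegral_poissonMeasure]
  have hterm : ∀ n : ℕ, Real.exp (-r) * (r : ℝ) ^ n / n.factorial * Real.exp (y * n) =
      Real.exp (-r) * ((r * Real.exp y) ^ n / n.factorial) := by
    intro n
    rw [mul_comm y, Real.exp_nat_mul, mul_pow]
    ring
  have hs : HasSum (fun n : ℕ => Real.exp (-r) * ((r * Real.exp y) ^ n / n.factorial))
      (Real.exp (r * (Real.exp y - 1))) := by
    have := (NormedSpace.expSeries_div_hasSum_exp ((r : ℝ) * Real.exp y)).mul_left (Real.exp (-r))
    rwa [← Real.exp_eq_exp_ℝ, ← Real.exp_add, show -(r : ℝ) + r * Real.exp y =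
      r * (Real.exp y - 1) by ring] at this
  rw [← hs.tsum_eq, ENNReal.ofReal_tsum_of_nonneg (fun n => by positivity) hs.summable]
  refine tsum_congr fun n => ?_
  rw [← ENNReal.ofReal_mul (by positivity), hterm]

/-- The probability is 1 - e^{-r}(1 + r), and e^{-r} ≥ 1 - r. A quadratic bound is what makes a sum
over ever finer cells vanish in the limit. -/
lemma poissonMeasure_two_le (r : ℝ≥0) :
    poissonMeasure r {n | 2 ≤ n} ≤ ENNReal.ofReal ((r : ℝ) ^ 2) := by
  have h : (poissonMeasure r).real {n | 2 ≤ n} = 1 - Real.exp (-r) * (1 + r) := by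
    have hc : {n : ℕ | 2 ≤ n}ᶜ = {0} ∪ {1} := by
      ext n
      simp only [Set.mem_compl_iff, Set.mem_ofPred_eq, Set.mem_union, Set.mem_singleton_iff]
      omega
    have h1 := probReal_compl_eq_one_sub (μ := poissonMeasure r)
      (s := {n : ℕ | 2 ≤ n}) (MeasurableSet.of_discrete)
    rw [hc, measureReal_union (by simp) (measurableSet_singleton _),
      poissonMeasure_real_singleton, poissonMeasure_real_singleton] at h1
    simp at h1
    linarith
  rw [← ENNReal.ofReal_toReal (measure_ne_top (poissonMeasure r) _)]
  refine ENNReal.ofReal_le_ofReal (h.le.trans ?_)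
  nlinarith [Real.add_one_le_exp (-(r : ℝ)), r.coe_nonneg]

/-! ### Elementary properties of Poisson random measures -/

namespace IsPoissonRandomMeasure

variable {Ω : Type*} {mΩ : MeasurableSpace Ω} {𝓕 : Filtration ℝ≥0 mΩ} {P : Measure Ω} {T : ℝ≥0}
  {ν : Measure ℝ} {N : Ω → Measure (ℝ≥0 × ℝ)}

/-- Adaptedness only concerns sets bounded in time, so B is exhausted by its parts up to time n. -/
lemma measurable_apply (hN : IsPoissonRandomMeasure 𝓕 P T ν N) {B : Set (ℝ≥0 × ℝ)}
    (hB : MeasurableSet B) : Measurable fun ω => N ω B := by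
  have h : ∀ ω, N ω B = ⨆ n : ℕ, N ω (B ∩ Set.Iic (n : ℝ≥0) ×ˢ Set.univ) := by
    intro ω
    rw [← Monotone.measure_iUnion]
    · congr 1
      ext p
      simp only [Set.mem_iUnion, Set.mem_inter_iff, Set.mem_prod, Set.mem_Iic, Set.mem_univ,
        and_true, exists_and_left]
      exact ⟨fun hp => ⟨hp, exists_nat_ge p.1⟩, fun hp => hp.1⟩
    · intro m n hmn
      refine Set.inter_subset_inter_right _ (Set.prod_mono (Set.Iic_subset_Iic.mpr ?_) le_rfl)
      exact_mod_cast hmn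
  simp_rw [h]
  refine Measurable.iSup fun n => ?_
  exact (hN.adapted n _ (hB.inter (measurableSet_Iic.prod MeasurableSet.univ))
    Set.inter_subset_right).mono (𝓕.le _) le_rfl

variable [IsFiniteMeasure ν]

lemma lintegral_comp (hN : IsPoissonRandomMeasure 𝓕 P T ν N) {B : Set (ℝ≥0 × ℝ)}
    (hB : MeasurableSet B) {φ : ℝ≥0∞ → ℝ≥0∞} (hφ : Measurable φ) :
    ∫⁻ ω, φ (N ω B) ∂P = ∫⁻ n : ℕ, φ n ∂(poissonMeasure (intensity T ν B).toNNReal) := by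
  rw [← lintegral_map hφ (hN.measurable_apply hB), hN.poisson B hB (measure_ne_top _ _),
    lintegral_map hφ (measurable_of_countable _)]

lemma measure_preimage (hN : IsPoissonRandomMeasure 𝓕 P T ν N) {B : Set (ℝ≥0 × ℝ)}
    (hB : MeasurableSet B) {s : Set ℝ≥0∞} (hs : MeasurableSet s) :
    P {ω | N ω B ∈ s} = poissonMeasure (intensity T ν B).toNNReal {n : ℕ | (n : ℝ≥0∞) ∈ s} := by
  have h : P {ω | N ω B ∈ s} = P.map (fun ω => N ω B) s :=
    (Measure.map_apply (hN.measurable_apply hB) hs).symm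
  rw [h, hN.poisson B hB (measure_ne_top _ _), Measure.map_apply (measurable_of_countable _) hs]
  rfl

lemma ae_univ_ne_top (hN : IsPoissonRandomMeasure 𝓕 P T ν N) : ∀ᵐ ω ∂P, N ω Set.univ ≠ ∞ := by
  have h := hN.measure_preimage MeasurableSet.univ (measurableSet_singleton ∞)
  simpa [ae_iff] using h

lemma ae_eq_zero (hN : IsPoissonRandomMeasure 𝓕 P T ν N) {B : Set (ℝ≥0 × ℝ)}
    (hB : MeasurableSet B) (h0 : intensity T ν B = 0) : ∀ᵐ ω ∂P, N ω B = 0 := by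
  have h := hN.measure_preimage hB (measurableSet_singleton 0).compl
  rw [h0, ENNReal.toNNReal_zero] at h
  rw [ae_iff]
  refine h.trans ?_
  have h1 : poissonMeasure 0 {0} = 1 := by simp [poissonMeasure_singleton]
  have : {n : ℕ | (n : ℝ≥0∞) ∈ ({0} : Set ℝ≥0∞)ᶜ} = {0}ᶜ := by ext n; simp
  rw [this, (prob_compl_eq_zero_iff (measurableSet_singleton 0)).mpr h1]

/-- The probability of having no point in B is the exponential of minus the intensity, which is 1
only for intensity zero. Together with `ae_eq_zero` this carries null sets from one compensator to
another. -/
lemma intensity_eq_zero [IsProbabilityMeasure P] (hN : IsPoissonRandomMeasure 𝓕 P T ν N)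
    {B : Set (ℝ≥0 × ℝ)} (hB : MeasurableSet B) (h0 : ∀ᵐ ω ∂P, N ω B = 0) :
    intensity T ν B = 0 := by
  have h := hN.measure_preimage hB (measurableSet_singleton 0)
  have h1 : P {ω | N ω B ∈ ({0} : Set ℝ≥0∞)} = 1 := by
    exact (prob_compl_eq_zero_iff (hN.measurable_apply hB (measurableSet_singleton 0))).mp h0
  have h2 : {n : ℕ | (n : ℝ≥0∞) ∈ ({0} : Set ℝ≥0∞)} = {0} := by ext n; simp
  rw [h1, h2, poissonMeasure_singleton] at h
  simp only [pow_zero, mul_one, Nat.factorial_zero, Nat.cast_one, div_one] at h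
  rw [eq_comm, ENNReal.ofReal_eq_one, Real.exp_eq_one_iff, neg_eq_zero, NNReal.coe_eq_zero,
    ENNReal.toNNReal_eq_zero_iff] at h
  exact h.resolve_right (measure_ne_top _ _)

/-- Almost surely no two points occur at the same time. -/
lemma ae_simple [IsProbabilityMeasure P] (hN : IsPoissonRandomMeasure 𝓕 P T ν N) :
    ∀ᵐ ω ∂P, ∀ s : ℝ≥0, N ω ({s} ×ˢ Set.univ) ≤ 1 := by
  set lam : ℝ := T * ν.real Set.univ with hlam
  -- the cells of the partition of `(0, T]` into `n + 1` intervals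
  let cell : ℕ → ℕ → Set (ℝ≥0 × ℝ) := fun n j =>
    Set.Ioc (T * (j / (n + 1))) (T * ((j + 1) / (n + 1))) ×ˢ Set.univ
  have hcellm : ∀ n j, MeasurableSet (cell n j) := fun n j =>
    measurableSet_Ioc.prod MeasurableSet.univ
  have hcell : ∀ n, ∀ j ∈ Finset.range (n + 1), P {ω | N ω (cell n j) ∈ Set.Ici 2} ≤
      ENNReal.ofReal ((lam / (n + 1)) ^ 2) := by
    intro n j hj
    have hj1 : (j + 1 : ℝ≥0) / (n + 1) ≤ 1 := by
      rw [div_le_one (by positivity)]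
      exact_mod_cast Finset.mem_range.mp hj
    rw [hN.measure_preimage (hcellm n j) measurableSet_Ici]
    have hset : {m : ℕ | (m : ℝ≥0∞) ∈ Set.Ici (2 : ℝ≥0∞)} = {m | 2 ≤ m} := by
      ext m
      simp only [Set.mem_Ici, Set.mem_ofPred_eq]
      exact_mod_cast Iff.rfl
    rw [hset]
    refine (poissonMeasure_two_le _).trans_eq ?_
    congr 2
    rw [intensity_Ioc_prod (by simpa using mul_le_mul_of_nonneg_left hj1 T.2), ENNReal.coe_toNNReal_eq_toReal,
      ENNReal.toReal_mul, ENNReal.toReal_ofReal, hlam, measureReal_def]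
    · push_cast; field_simp; ring
    · push_cast
      have := T.coe_nonneg
      rw [← mul_sub]
      refine mul_nonneg this ?_
      rw [← sub_div]
      exact div_nonneg (by linarith) (by positivity)
  have hunion : ∀ n : ℕ, P (⋃ j ∈ Finset.range (n + 1), {ω | N ω (cell n j) ∈ Set.Ici 2}) ≤
      ENNReal.ofReal (lam ^ 2 / (n + 1)) := by
    intro n
    refine (measure_biUnion_finset_le _ _).trans ((Finset.sum_le_sum (hcell n)).trans_eq ?_)
    rw [Finset.sum_const, Finset.card_range, nsmul_eq_mul, ← ENNReal.ofReal_natCast,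
      ← ENNReal.ofReal_mul (by positivity)]
    congr 1
    push_cast
    field_simp
  -- Two simultaneous points share a cell of every partition, so only the intersection over n has to
  -- be null; it is enough that the probabilities tend to 0.
  have hnull : P (⋂ n : ℕ, ⋃ j ∈ Finset.range (n + 1), {ω | N ω (cell n j) ∈ Set.Ici 2}) = 0 := by
    have hlim : Tendsto (fun n : ℕ => ENNReal.ofReal (lam ^ 2 / (n + 1))) atTop (𝓝 0) := by
      rw [← ENNReal.ofReal_zero]
      refine ENNReal.tendsto_ofReal (tendsto_const_nhds.div_atTop ?_)
      exact tendsto_atTop_add_const_right _ _ tendsto_natCast_atTop_atTop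
    refine le_antisymm (ge_of_tendsto' hlim fun n => ?_) zero_le
    exact (measure_mono (Set.iInter_subset _ n)).trans (hunion n)
  have hout : ∀ᵐ ω ∂P, N ω ((Set.Ioc 0 T)ᶜ ×ˢ Set.univ) = 0 := by
    refine hN.ae_eq_zero (measurableSet_Ioc.compl.prod MeasurableSet.univ) ?_
    rw [intensity, Measure.prod_prod, show timeMeasure T (Set.Ioc 0 T)ᶜ = 0 from ae_timeMeasure_mem T, zero_mul]
  filter_upwards [hout, measure_eq_zero_iff_ae_notMem.mp hnull, hN.counting] with ω h1 h2 h3 s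
  by_contra! hs
  by_cases hsT : s ∈ Set.Ioc 0 T
  · refine h2 (Set.mem_iInter.mpr fun n => ?_)
    have hT0 : 0 < T := hsT.1.trans_le hsT.2
    have hpos : 0 < s / T * (n + 1) := by have := hsT.1; positivity
    obtain ⟨j, hj⟩ : ∃ j : ℕ, ⌈s / T * (n + 1)⌉₊ = j + 1 :=
      Nat.exists_eq_succ_of_ne_zero (Nat.ceil_pos.mpr hpos).ne'
    have hle := Nat.le_ceil (s / T * (n + 1))
    have hlt := Nat.ceil_lt_add_one hpos.le
    rw [hj] at hle hlt
    push_cast at hle hlt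
    have hlt' : (j : ℝ≥0) < s / T * (n + 1) := lt_of_add_lt_add_right hlt
    refine Set.mem_biUnion (x := j) ?_ ?_
    · rw [Finset.coe_range, Set.mem_Iio]
      have : s / T * (n + 1) ≤ (n + 1 : ℕ) := by
        push_cast
        exact mul_le_of_le_one_left (by positivity) (div_le_one_of_le₀ hsT.2 zero_le)
      have := Nat.ceil_le.mpr this
      omega
    · have hmem : s ∈ Set.Ioc (T * (j / (n + 1))) (T * ((j + 1) / (n + 1))) := by
        constructor
        · rw [← mul_div_assoc, div_lt_iff₀ (by positivity)]
          calc T * (j : ℝ≥0) < T * (s / T * (n + 1)) := mul_lt_mul_of_pos_left hlt' hT0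
            _ = s * (n + 1) := by field_simp
        · rw [← mul_div_assoc, le_div_iff₀ (by positivity)]
          calc s * (n + 1 : ℝ≥0) = T * (s / T * (n + 1)) := by field_simp
            _ ≤ T * (j + 1) := mul_le_mul_of_nonneg_left hle T.2
      obtain ⟨m, hm⟩ := h3 _ (hcellm n j)
      have h4 : 1 < N ω (cell n j) := hs.trans_le (measure_mono
        (Set.prod_mono (Set.singleton_subset_iff.mpr hmem) le_rfl))
      rw [Set.mem_ofPred_eq, Set.mem_Ici]
      rw [hm] at h4 ⊢
      have h5 : (1 : ℕ∞) < m := by exact_mod_cast h4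
      have h6 : (2 : ℕ∞) ≤ m := by
        have := Order.add_one_le_of_lt h5
        rwa [one_add_one_eq_two] at this
      exact_mod_cast h6
  · have : N ω ({s} ×ˢ Set.univ) ≤ 0 := h1 ▸ measure_mono
      (Set.prod_mono (Set.singleton_subset_iff.mpr hsT) le_rfl)
    exact absurd (hs.trans_le this) (by simp)

/-- Almost surely `N` is a finite sum of point masses at distinct times in `(0, T]`, with marks in
a given set of full measure. -/
lemma ae_exists_eq_sum_dirac [IsProbabilityMeasure P] (hN : IsPoissonRandomMeasure 𝓕 P T ν N)
    {E : Set ℝ} (hE : MeasurableSet E) (hνE : ν Eᶜ = 0) :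
    ∀ᵐ ω ∂P, ∃ (S : Finset ℝ≥0) (x : ℝ≥0 → ℝ), N ω = ∑ s ∈ S, Measure.dirac (s, x s) ∧
      ∀ s ∈ S, s ∈ Set.Ioc 0 T ∧ x s ∈ E := by
  have hout : ∀ᵐ ω ∂P, N ω (Set.Ioc 0 T ×ˢ E)ᶜ = 0 := by
    refine hN.ae_eq_zero (measurableSet_Ioc.prod hE).compl ?_
    rw [Set.compl_prod_eq_union]
    refine measure_union_null ?_ ?_
    · rw [intensity, Measure.prod_prod, show timeMeasure T (Set.Ioc 0 T)ᶜ = 0 from ae_timeMeasure_mem T,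
        zero_mul]
    · rw [intensity, Measure.prod_prod, hνE, mul_zero]
  filter_upwards [hout, hN.ae_simple, hN.counting, hN.ae_univ_ne_top] with ω h1 h2 h3 h4
  obtain ⟨S, x, hSx⟩ := exists_eq_sum_dirac (N ω) h4 h3 h2
  refine ⟨S, x, hSx, fun s hs => ?_⟩
  rw [hSx, Measure.finsetSum_apply, Finset.sum_eq_zero_iff] at h1
  have := h1 s hs
  rw [Measure.dirac_apply' _ (measurableSet_Ioc.prod hE).compl] at this
  by_contra hcon
  rw [Set.indicator_of_mem (show (s, x s) ∈ (Set.Ioc 0 T ×ˢ E)ᶜ from hcon)] at this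
  simp at this

end IsPoissonRandomMeasure

/-! ### Sums over the points of an integer valued measure -/

/-- The integral of `h` against `M`, written so that it is measurable in `M`. -/
def pointSum (h : ℝ≥0 × ℝ → ℝ) (M : Measure (ℝ≥0 × ℝ)) : ℝ :=
  (∫⁻ p, ENNReal.ofReal (h p) ∂M).toReal - (∫⁻ p, ENNReal.ofReal (-h p) ∂M).toReal

lemma measurable_pointSum {h : ℝ≥0 × ℝ → ℝ} (hh : Measurable h) : Measurable (pointSum h) :=
  (Measure.measurable_lintegral hh.ennreal_ofReal).ennreal_toReal.sub
    (Measure.measurable_lintegral hh.neg.ennreal_ofReal).ennreal_toReal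

lemma pointSum_eq_integral {h : ℝ≥0 × ℝ → ℝ} {M : Measure (ℝ≥0 × ℝ)} (hh : Integrable h M) :
    pointSum h M = ∫ p, h p ∂M :=
  (integral_eq_lintegral_pos_part_sub_lintegral_neg_part hh).symm

lemma pointSum_restrict (h : ℝ≥0 × ℝ → ℝ) (M : Measure (ℝ≥0 × ℝ)) {A : Set (ℝ≥0 × ℝ)}
    (hA : MeasurableSet A) : pointSum h (M.restrict A) = pointSum (A.indicator h) M := by
  have hind : ∀ g : ℝ≥0 × ℝ → ℝ, ∫⁻ p, ENNReal.ofReal (g p) ∂(M.restrict A) =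
      ∫⁻ p, ENNReal.ofReal (A.indicator g p) ∂M := by
    intro g
    rw [← lintegral_indicator hA]
    refine lintegral_congr fun p => ?_
    by_cases hp : p ∈ A <;> simp [hp]
  rw [pointSum, pointSum, hind, hind fun p => -h p]
  congr 3
  ext p
  by_cases hp : p ∈ A <;> simp [hp]

lemma integrable_sum_dirac (h : ℝ≥0 × ℝ → ℝ) (S : Finset ℝ≥0) (x : ℝ≥0 → ℝ) :
    Integrable h (∑ s ∈ S, Measure.dirac (s, x s)) :=
  integrable_finsetSum_measure.mpr fun _ _ => integrable_dirac enorm_lt_top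

lemma integral_sum_dirac (h : ℝ≥0 × ℝ → ℝ) (S : Finset ℝ≥0) (x : ℝ≥0 → ℝ) :
    ∫ p, h p ∂(∑ s ∈ S, Measure.dirac (s, x s)) = ∑ s ∈ S, h (s, x s) := by
  rw [integral_finsetSum_measure fun s _ => integrable_dirac enorm_lt_top]
  simp

lemma pointSum_sum_dirac (h : ℝ≥0 × ℝ → ℝ) (S : Finset ℝ≥0) (x : ℝ≥0 → ℝ) :
    pointSum h (∑ s ∈ S, Measure.dirac (s, x s)) = ∑ s ∈ S, h (s, x s) := by
  rw [pointSum_eq_integral (integrable_sum_dirac h S x), integral_sum_dirac]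

/-! ### The Laplace functional of a Poisson random measure -/

/-- Positive and negative parts are approximated separately from below. Only the upper bound is
recorded: it controls e^f, while h may be unbounded below. -/
lemma exists_simpleFunc_tendsto {h : ℝ≥0 × ℝ → ℝ} (hh : Measurable h) :
    ∃ f : ℕ → SimpleFunc (ℝ≥0 × ℝ) ℝ, (∀ n p, f n p ≤ max (h p) 0) ∧
      ∀ p, Tendsto (fun n => f n p) atTop (𝓝 (h p)) := by
  let u : (ℝ≥0 × ℝ → ℝ) → ℕ → SimpleFunc (ℝ≥0 × ℝ) ℝ := fun g n =>
    (SimpleFunc.eapprox (fun p => ENNReal.ofReal (g p)) n).map ENNReal.toReal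
  have hu_le : ∀ (g : ℝ≥0 × ℝ → ℝ), Measurable g → ∀ n p, u g n p ≤ max (g p) 0 := by
    intro g hg n p
    have h1 : SimpleFunc.eapprox (fun p => ENNReal.ofReal (g p)) n p ≤ ENNReal.ofReal (g p) := by
      rw [← SimpleFunc.iSup_eapprox_apply hg.ennreal_ofReal p]
      exact le_iSup (fun n => SimpleFunc.eapprox (fun p => ENNReal.ofReal (g p)) n p) n
    have h2 := ENNReal.toReal_mono ENNReal.ofReal_ne_top h1
    rwa [ENNReal.toReal_ofReal'] at h2
  have hu_lim : ∀ (g : ℝ≥0 × ℝ → ℝ), Measurable g → ∀ p,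
      Tendsto (fun n => u g n p) atTop (𝓝 (max (g p) 0)) := by
    intro g hg p
    have h1 := SimpleFunc.tendsto_eapprox hg.ennreal_ofReal p
    have h2 := (ENNReal.tendsto_toReal ENNReal.ofReal_ne_top).comp h1
    rwa [ENNReal.toReal_ofReal'] at h2
  refine ⟨fun n => u h n - u (fun p => -h p) n, fun n p => ?_, fun p => ?_⟩
  · have h1 : 0 ≤ u (fun p => -h p) n p := ENNReal.toReal_nonneg
    have h2 := hu_le h hh n p
    rw [SimpleFunc.sub_apply]
    linarith
  · have h1 := (hu_lim h hh p).sub (hu_lim _ hh.neg p)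
    have h2 : max (h p) 0 - max ((-h) p) 0 = h p := max_zero_sub_max_neg_zero_eq_self (h p)
    rw [h2] at h1
    exact h1

namespace IsPoissonRandomMeasure

variable {Ω : Type*} {mΩ : MeasurableSpace Ω} {𝓕 : Filtration ℝ≥0 mΩ} {P : Measure Ω} {T : ℝ≥0}
  {ν : Measure ℝ} {N : Ω → Measure (ℝ≥0 × ℝ)}

lemma measurable (hN : IsPoissonRandomMeasure 𝓕 P T ν N) : Measurable N :=
  Measure.measurable_of_measurable_coe _ fun _ hB => hN.measurable_apply hB

variable [IsFiniteMeasure ν]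

lemma lintegral_exp_mul_apply (hN : IsPoissonRandomMeasure 𝓕 P T ν N) {B : Set (ℝ≥0 × ℝ)}
    (hB : MeasurableSet B) (y : ℝ) :
    ∫⁻ ω, ENNReal.ofReal (Real.exp (y * (N ω B).toReal)) ∂P =
      ENNReal.ofReal (Real.exp ((intensity T ν).real B * (Real.exp y - 1))) := by
  rw [hN.lintegral_comp hB (φ := fun z => ENNReal.ofReal (Real.exp (y * z.toReal)))
    (by fun_prop)]
  simpa using! lintegral_exp_poissonMeasure (intensity T ν B).toNNReal y

/-- For a simple function the integral against N is a linear combination of the numbers of points in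
the fibres, which are independent Poisson variables; the expectation of the exponential factorises.
-/
lemma lintegral_exp_pointSum_simpleFunc (hN : IsPoissonRandomMeasure 𝓕 P T ν N)
    (f : SimpleFunc (ℝ≥0 × ℝ) ℝ) :
    ∫⁻ ω, ENNReal.ofReal (Real.exp (pointSum f (N ω))) ∂P =
      ENNReal.ofReal (Real.exp (∫ p, (Real.exp (f p) - 1) ∂(intensity T ν))) := by
  have hfib : ∀ y : ℝ, MeasurableSet (f ⁻¹' {y}) := fun y => f.measurableSet_fiber y
  have hleft : ∀ᵐ ω ∂P, ENNReal.ofReal (Real.exp (pointSum f (N ω))) =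
      ∏ y ∈ f.range, ENNReal.ofReal (Real.exp (y * (N ω (f ⁻¹' {y})).toReal)) := by
    filter_upwards [hN.ae_univ_ne_top] with ω hω
    have : IsFiniteMeasure (N ω) := ⟨lt_top_iff_ne_top.mpr hω⟩
    have hint : Integrable f (N ω) := SimpleFunc.integrable_of_isFiniteMeasure f
    rw [pointSum_eq_integral hint, SimpleFunc.integral_eq_sum f hint, Real.exp_sum,
      ENNReal.ofReal_prod_of_nonneg fun _ _ => (Real.exp_pos _).le]
    refine Finset.prod_congr rfl fun y _ => ?_
    rw [smul_eq_mul, mul_comm, measureReal_def]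
  have hright : ∫ p, (Real.exp (f p) - 1) ∂(intensity T ν) =
      ∑ y ∈ f.range, (intensity T ν).real (f ⁻¹' {y}) * (Real.exp y - 1) := by
    have h1 := SimpleFunc.map_integral f (fun y => Real.exp y - 1)
      (SimpleFunc.integrable_of_isFiniteMeasure (μ := intensity T ν) f) (by simp)
    rw [SimpleFunc.integral_eq_integral _ (SimpleFunc.integrable_of_isFiniteMeasure _)] at h1
    exact h1
  have hind := hN.indep_disjoint f.range.card (fun i => f ⁻¹' {(f.range.equivFin.symm i : ℝ)})
    (fun i => hfib _) (fun i j hij => by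
      refine Disjoint.preimage _ ?_
      rw [Set.disjoint_singleton]
      exact fun h => hij (f.range.equivFin.symm.injective (Subtype.ext h)))
  have hind' := hind.comp
    (fun i z => ENNReal.ofReal (Real.exp ((f.range.equivFin.symm i : ℝ) * z.toReal)))
    (fun i => by fun_prop)
  have hreindex : ∀ F : ℝ → ℝ≥0∞, ∏ y ∈ f.range, F y =
      ∏ i : Fin f.range.card, F (f.range.equivFin.symm i) := by
    intro F
    rw [← Finset.prod_coe_sort]
    exact (Equiv.prod_comp f.range.equivFin.symm fun y : f.range => F y).symm
  rw [lintegral_congr_ae hleft, hright, Real.exp_sum,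
    ENNReal.ofReal_prod_of_nonneg fun _ _ => (Real.exp_pos _).le]
  simp_rw [hreindex]
  have h2 := lintegral_prod_eq_prod_lintegral_of_indepFun Finset.univ _ hind' (fun i => by
    have := hN.measurable_apply (hfib (f.range.equivFin.symm i))
    fun_prop)
  refine h2.trans (Finset.prod_congr rfl fun i _ => ?_)
  exact hN.lintegral_exp_mul_apply (hfib _) _

variable [IsProbabilityMeasure P]

/-- Fatou's lemma along simple functions below h. This one-sided bound supplies the dominating
variable for the equality in `lintegral_exp_pointSum`. -/
lemma lintegral_exp_pointSum_le (hN : IsPoissonRandomMeasure 𝓕 P T ν N) {h : ℝ≥0 × ℝ → ℝ}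
    (hh : Measurable h) (h0 : ∀ p, 0 ≤ h p)
    (hint : Integrable (fun p => Real.exp (h p)) (intensity T ν)) :
    ∫⁻ ω, ENNReal.ofReal (Real.exp (pointSum h (N ω))) ∂P ≤
      ENNReal.ofReal (Real.exp (∫ p, (Real.exp (h p) - 1) ∂(intensity T ν))) := by
  obtain ⟨f, hf_le, hf_lim⟩ := exists_simpleFunc_tendsto hh
  have hlim : ∀ᵐ ω ∂P, ENNReal.ofReal (Real.exp (pointSum h (N ω))) ≤
      liminf (fun n => ENNReal.ofReal (Real.exp (pointSum (f n) (N ω)))) atTop := by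
    filter_upwards [hN.ae_exists_eq_sum_dirac MeasurableSet.univ (by simp)] with ω ⟨S, x, hSx, _⟩
    refine (Tendsto.liminf_eq ?_).ge
    simp_rw [hSx, pointSum_sum_dirac]
    exact ENNReal.tendsto_ofReal ((Real.continuous_exp.tendsto _).comp
      (tendsto_finsetSum _ fun s _ => hf_lim _))
  refine (lintegral_mono_ae hlim).trans ((lintegral_liminf_le fun n => ?_).trans ?_)
  · exact ((measurable_pointSum (f n).measurable).comp hN.measurable).exp.ennreal_ofReal
  · refine (liminf_le_of_frequently_le' (Frequently.of_forall fun n => ?_))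
    rw [hN.lintegral_exp_pointSum_simpleFunc]
    refine ENNReal.ofReal_le_ofReal (Real.exp_le_exp.mpr ?_)
    refine integral_mono ?_ (hint.sub (integrable_const 1)) fun p => ?_
    · exact ((SimpleFunc.integrable_of_isFiniteMeasure ((f n).map Real.exp))).sub
        (integrable_const 1)
    · have := hf_le n p
      rw [max_eq_left (h0 p)] at this
      exact sub_le_sub_right (Real.exp_le_exp.mpr this) 1

/-- The exponential formula `𝔼 exp (∫ h dN) = exp (∫ (e^h - 1) dμ)` for a Poisson random measure
`N` with intensity `μ`. -/
lemma lintegral_exp_pointSum (hN : IsPoissonRandomMeasure 𝓕 P T ν N) {h : ℝ≥0 × ℝ → ℝ}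
    (hh : Measurable h) (hint : Integrable (fun p => Real.exp (h p)) (intensity T ν)) :
    ∫⁻ ω, ENNReal.ofReal (Real.exp (pointSum h (N ω))) ∂P =
      ENNReal.ofReal (Real.exp (∫ p, (Real.exp (h p) - 1) ∂(intensity T ν))) := by
  obtain ⟨f, hf_le, hf_lim⟩ := exists_simpleFunc_tendsto hh
  have hmax : ∀ p, Real.exp (max (h p) 0) ≤ Real.exp (h p) + 1 := by
    intro p
    rcases max_cases (h p) 0 with ⟨h1, _⟩ | ⟨h1, _⟩ <;> rw [h1]
    · linarith
    · rw [Real.exp_zero]; linarith [Real.exp_pos (h p)]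
  have hintmax : Integrable (fun p => Real.exp (max (h p) 0)) (intensity T ν) := by
    refine (hint.add (integrable_const 1)).mono'
      (hh.max measurable_const).exp.aestronglyMeasurable (ae_of_all _ fun p => ?_)
    rw [Real.norm_eq_abs, Real.abs_exp]
    exact hmax p
  have hL : Tendsto (fun n => ∫⁻ ω, ENNReal.ofReal (Real.exp (pointSum (f n) (N ω))) ∂P) atTop
      (𝓝 (∫⁻ ω, ENNReal.ofReal (Real.exp (pointSum h (N ω))) ∂P)) := by
    -- The dominating variable is exp(∫ max(h, 0) dN). Pointwise convergence is that of finite sums,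
    -- since almost every path has finitely many points.
    refine tendsto_lintegral_of_dominated_convergence
      (fun ω => ENNReal.ofReal (Real.exp (pointSum (fun p => max (h p) 0) (N ω))))
      (fun n => ((measurable_pointSum (f n).measurable).comp hN.measurable).exp.ennreal_ofReal)
      (fun n => ?_)
      ((hN.lintegral_exp_pointSum_le (hh.max measurable_const) (fun p => le_max_right _ _)
        hintmax).trans_lt ENNReal.ofReal_lt_top).ne ?_
    · filter_upwards [hN.ae_exists_eq_sum_dirac MeasurableSet.univ (by simp)] with ω ⟨S, x, hSx, _⟩
      rw [hSx, pointSum_sum_dirac, pointSum_sum_dirac]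
      exact ENNReal.ofReal_le_ofReal (Real.exp_le_exp.mpr
        (Finset.sum_le_sum fun s _ => hf_le n _))
    · filter_upwards [hN.ae_exists_eq_sum_dirac MeasurableSet.univ (by simp)] with ω ⟨S, x, hSx, _⟩
      simp_rw [hSx, pointSum_sum_dirac]
      exact ENNReal.tendsto_ofReal ((Real.continuous_exp.tendsto _).comp
        (tendsto_finsetSum _ fun s _ => hf_lim _))
  have hR : Tendsto (fun n => ∫ p, (Real.exp (f n p) - 1) ∂(intensity T ν)) atTop
      (𝓝 (∫ p, (Real.exp (h p) - 1) ∂(intensity T ν))) := by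
    refine tendsto_integral_of_dominated_convergence (fun p => Real.exp (max (h p) 0) + 1)
      (fun n => ((f n).measurable.exp.sub measurable_const).aestronglyMeasurable)
      (hintmax.add (integrable_const 1)) (fun n => ae_of_all _ fun p => ?_)
      (ae_of_all _ fun p => ((Real.continuous_exp.tendsto _).comp (hf_lim p)).sub_const 1)
    refine (norm_sub_le _ _).trans ?_
    rw [Real.norm_eq_abs, Real.abs_exp, norm_one]
    exact add_le_add_left (Real.exp_le_exp.mpr (hf_le n p)) 1
  simp_rw [hN.lintegral_exp_pointSum_simpleFunc] at hL
  exact tendsto_nhds_unique hL (ENNReal.tendsto_ofReal ((Real.continuous_exp.tendsto _).comp hR))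

end IsPoissonRandomMeasure

section Predictable

/-! ### Predictability of left limits -/

/-- The largest multiple of `1 / (n + 1)` that is smaller than `t`, or `0` for `t = 0`. -/
def leftGrid (n : ℕ) (t : ℝ≥0) : ℝ≥0 :=
  ((⌈t * (n + 1)⌉₊ - 1 : ℕ) : ℝ≥0) / (n + 1)

lemma leftGrid_zero (n : ℕ) : leftGrid n 0 = 0 := by simp [leftGrid]

lemma exists_mem_Ioc_grid (n : ℕ) {t : ℝ≥0} (ht : 0 < t) :
    ∃ j : ℕ, t ∈ Set.Ioc ((j : ℝ≥0) / (n + 1)) ((j + 1) / (n + 1)) := by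
  have hpos : 0 < t * (n + 1) := by positivity
  obtain ⟨j, hj⟩ : ∃ j : ℕ, ⌈t * (n + 1)⌉₊ = j + 1 :=
    Nat.exists_eq_succ_of_ne_zero (Nat.ceil_pos.mpr hpos).ne'
  have hle := Nat.le_ceil (t * (n + 1))
  have hlt := Nat.ceil_lt_add_one hpos.le
  rw [hj] at hle hlt
  push_cast at hle hlt
  exact ⟨j, (div_lt_iff₀ (by positivity)).mpr (lt_of_add_lt_add_right hlt),
    (le_div_iff₀ (by positivity)).mpr hle⟩

lemma leftGrid_of_mem {n j : ℕ} {t : ℝ≥0}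
    (ht : t ∈ Set.Ioc ((j : ℝ≥0) / (n + 1)) ((j + 1) / (n + 1))) :
    leftGrid n t = j / (n + 1) := by
  have h1 : (j : ℝ≥0) < t * (n + 1) := (div_lt_iff₀ (by positivity)).mp ht.1
  have h2 : t * (n + 1) ≤ (j + 1 : ℕ) := by
    push_cast
    exact (le_div_iff₀ (by positivity)).mp ht.2
  have h3 : ⌈t * (n + 1)⌉₊ = j + 1 :=
    le_antisymm (Nat.ceil_le.mpr h2) (Nat.lt_ceil.mpr h1)
  rw [leftGrid, h3, Nat.add_sub_cancel]

lemma tendsto_leftGrid {t : ℝ≥0} (ht : 0 < t) :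
    Tendsto (fun n => leftGrid n t) atTop (𝓝[<] t) := by
  have hlt : ∀ n, leftGrid n t < t ∧ t ≤ leftGrid n t + 1 / ((n : ℝ≥0) + 1) := by
    intro n
    obtain ⟨j, hj⟩ := exists_mem_Ioc_grid n ht
    rw [leftGrid_of_mem hj, ← add_div]
    exact hj
  refine tendsto_nhdsWithin_iff.mpr ⟨?_, Eventually.of_forall fun n => (hlt n).1⟩
  have h1 : Tendsto (fun n : ℕ => t - 1 / ((n : ℝ≥0) + 1)) atTop (𝓝 t) := by
    simpa using tendsto_const_nhds.sub (tendsto_div_add_one_nnreal 1)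
  exact tendsto_of_tendsto_of_tendsto_of_le_of_le h1 tendsto_const_nhds
    (fun n => tsub_le_iff_right.mpr (hlt n).2) fun n => (hlt n).1.le

variable {Ω : Type*} {mΩ : MeasurableSpace Ω}

lemma measurable_predictable_fst (𝓕 : Filtration ℝ≥0 mΩ) :
    Measurable[𝓕.predictable] (Prod.fst : ℝ≥0 × Ω → ℝ≥0) := by
  let : MeasurableSpace (ℝ≥0 × Ω) := 𝓕.predictable
  refine measurable_of_Ioi fun x => ?_
  have : (Prod.fst : ℝ≥0 × Ω → ℝ≥0) ⁻¹' Set.Ioi x = Set.Ioi x ×ˢ Set.univ := by ext; simp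
  rw [this]
  exact measurableSet_predictable_Ioi_prod MeasurableSet.univ

/-- The left limits of an adapted process that has left limits on `[0, T]` are predictable. -/
lemma measurable_predictable_leftValue (𝓕 : Filtration ℝ≥0 mΩ) (T : ℝ≥0) {Z : ℝ≥0 → Ω → ℝ}
    (hZ : ∀ t ≤ T, Measurable[𝓕 t] (Z t))
    (hlim : ∀ ω, ∀ t ≤ T, ∃ l, Tendsto (fun s => Z s ω) (𝓝[<] t) (𝓝 l)) :
    Measurable[𝓕.predictable]
      ({p : ℝ≥0 × Ω | p.1 ≤ T}.indicator fun p => leftValue Z p.1 p.2) := by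
  refine @measurable_of_tendsto_metrizable _ _ 𝓕.predictable _ _ _ _
    (fun n : ℕ => {p : ℝ≥0 × Ω | p.1 ≤ T}.indicator fun p => Z (leftGrid n p.1) p.2) _
    (fun n B hB => ?_) (tendsto_pi_nhds.mpr fun p => ?_)
  -- The discretised process takes on each grid interval the value at its left end, so preimages are
  -- countable unions of predictable rectangles. The intervals are cut at T because adaptedness is
  -- known only up to T; beyond T the value is 0.
  · have hset : ({p : ℝ≥0 × Ω | p.1 ≤ T}.indicator fun p => Z (leftGrid n p.1) p.2) ⁻¹' B =
        ({⊥} ×ˢ (Z 0 ⁻¹' B) ∪ (Set.Ioi T ×ˢ {_ω | (0 : ℝ) ∈ B}) ∪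
          ⋃ j : ℕ, Set.Ioc ((j : ℝ≥0) / (n + 1)) (min ((j + 1) / (n + 1)) T) ×ˢ
            (Z (j / (n + 1)) ⁻¹' B)) := by
      ext ⟨t, ω⟩
      simp only [Set.mem_preimage, Set.mem_union, Set.mem_prod, Set.mem_singleton_iff,
        Set.mem_Ioi, Set.mem_iUnion]
      rcases lt_or_ge T t with htT | htT
      · rw [Set.indicator_of_notMem (show (t, ω) ∉ {p : ℝ≥0 × Ω | p.1 ≤ T} from not_le.mpr htT)]
        refine ⟨fun h => Or.inl (Or.inr ⟨htT, h⟩), ?_⟩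
        rintro ((⟨h, _⟩ | ⟨_, h⟩) | ⟨j, h, _⟩)
        · exact absurd (h ▸ htT) not_lt_bot
        · exact h
        · exact absurd (h.2.trans (min_le_right _ _)) (not_le.mpr htT)
      · rw [Set.indicator_of_mem (show (t, ω) ∈ {p : ℝ≥0 × Ω | p.1 ≤ T} from htT)]
        rcases eq_or_ne t 0 with rfl | ht
        · rw [leftGrid_zero]
          refine ⟨fun h => Or.inl (Or.inl ⟨rfl, h⟩), ?_⟩
          rintro ((⟨_, h⟩ | ⟨h, _⟩) | ⟨j, h, _⟩)
          · exact h
          · exact absurd h (not_lt.mpr htT)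
          · exact absurd h.1 (not_lt.mpr zero_le)
        · constructor
          · intro h
            obtain ⟨j, hj⟩ := exists_mem_Ioc_grid n (pos_iff_ne_zero.mpr ht)
            refine Or.inr ⟨j, ⟨hj.1, le_min hj.2 htT⟩, ?_⟩
            rwa [leftGrid_of_mem hj] at h
          · rintro ((⟨h, _⟩ | ⟨h, _⟩) | ⟨j, h, h'⟩)
            · exact absurd h ht
            · exact absurd h (not_lt.mpr htT)
            · rwa [leftGrid_of_mem ⟨h.1, h.2.trans (min_le_left _ _)⟩]
    rw [hset]
    refine MeasurableSet.union (MeasurableSet.union ?_ ?_) (MeasurableSet.iUnion fun j => ?_)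
    · exact measurableSet_predictable_singleton_bot_prod (hZ 0 zero_le hB)
    · exact measurableSet_predictable_Ioi_prod (MeasurableSet.const _)
    · rcases le_total ((j : ℝ≥0) / (n + 1)) T with hj | hj
      · exact measurableSet_predictable_Ioc_prod _ _ (hZ _ hj hB)
      · rw [Set.Ioc_eq_empty (not_lt.mpr ((min_le_right _ _).trans hj)), Set.empty_prod]
        exact @MeasurableSet.empty _ 𝓕.predictable
  · obtain ⟨t, ω⟩ := p
    by_cases htT : t ≤ T
    · have hmem : (t, ω) ∈ {p : ℝ≥0 × Ω | p.1 ≤ T} := htT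
      simp only [Set.indicator_of_mem hmem]
      rcases eq_or_ne t 0 with rfl | ht
      · simp_rw [leftGrid_zero, leftValue, leftLim_eq_of_eq_bot _ nhdsLT_zero_eq_bot]
        exact tendsto_const_nhds
      · have ht0 := pos_iff_ne_zero.mpr ht
        have := nhdsLT_neBot ht0
        obtain ⟨l, hl⟩ := hlim ω t htT
        rw [leftValue, leftLim_eq_of_tendsto hl]
        exact hl.comp (tendsto_leftGrid ht0)
    · have hmem : (t, ω) ∉ {p : ℝ≥0 × Ω | p.1 ≤ T} := htT
      simp only [Set.indicator_of_notMem hmem]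
      exact tendsto_const_nhds

end Predictable

/-! ### The stochastic exponential -/

/-- The process `exp (c t + ∫_{(0, t] × ℝ₊} log g dN)`. -/
def jumpProcess {Ω : Type*} (c : ℝ) (g : ℝ → ℝ) (N : Ω → Measure (ℝ≥0 × ℝ)) (t : ℝ≥0) (ω : Ω) : ℝ :=
  Real.exp (c * t + pointSum (fun p => Real.log (g p.2)) ((N ω).restrict (Set.Iic t ×ˢ Set.univ)))

/-- `M` is a finite sum of point masses at distinct times in `(0, T]` with marks in `E`. -/
def HasSimplePoints (T : ℝ≥0) (E : Set ℝ) (M : Measure (ℝ≥0 × ℝ)) : Prop :=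
  ∃ (S : Finset ℝ≥0) (x : ℝ≥0 → ℝ), M = ∑ s ∈ S, Measure.dirac (s, x s) ∧
    ∀ s ∈ S, s ∈ Set.Ioc 0 T ∧ x s ∈ E

/-- Positivity of g at the marks is essential: `Real.log` is 0 at 0 and even, so otherwise the
exponential of the sum would not return the product of the factors. -/
lemma jumpProcess_eq_jumpExp {Ω : Type*} (c : ℝ) {g : ℝ → ℝ} {N : Ω → Measure (ℝ≥0 × ℝ)} {ω : Ω}
    {S : Finset ℝ≥0} {x : ℝ≥0 → ℝ} (hSx : N ω = ∑ s ∈ S, Measure.dirac (s, x s))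
    (hg : ∀ s ∈ S, 0 < g (x s)) (t : ℝ≥0) :
    jumpProcess c g N t ω = jumpExp c S (fun s => g (x s)) t := by
  rw [jumpProcess, pointSum_restrict _ _ (measurableSet_Iic.prod MeasurableSet.univ), hSx,
    pointSum_sum_dirac, Real.exp_add, Real.exp_sum, jumpExp]
  congr 1
  refine Finset.prod_congr rfl fun s hs => ?_
  by_cases hst : s ≤ t
  · rw [Set.indicator_of_mem (show (s, x s) ∈ Set.Iic t ×ˢ Set.univ from ⟨hst, trivial⟩),
      Real.exp_log (hg s hs), if_pos hst]
  · rw [Set.indicator_of_notMem (fun h => hst h.1), Real.exp_zero, if_neg hst]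

lemma ae_mem_marks (v : ℝ → ℝ) : ∀ᵐ ξ ∂(compensatorMeasure v), ξ ∈ marks :=
  (withDensity_absolutelyContinuous _ _).ae_le (ae_restrict_mem measurableSet_Ioi)

lemma restrict_marks (v : ℝ → ℝ) : (compensatorMeasure v).restrict marks = compensatorMeasure v :=
  Measure.restrict_eq_self_of_ae_mem (ae_mem_marks v)

lemma intensity_restrict (T t : ℝ≥0) (v : ℝ → ℝ) :
    (intensity T (compensatorMeasure v)).restrict (Set.Ioc 0 t ×ˢ marks) =
      ((timeMeasure T).restrict (Set.Ioc 0 t)).prod (compensatorMeasure v) := by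
  have : SFinite (compensatorMeasure v) := by unfold compensatorMeasure; infer_instance
  rw [intensity, ← Measure.prod_restrict, restrict_marks]

lemma setIntegral_timeMeasure {T t : ℝ≥0} (ht : t ≤ T) {L : ℝ≥0 → ℝ} (hL : Measurable L) :
    ∫ s in Set.Ioc 0 t, L s ∂(timeMeasure T) = ∫ u in (0 : ℝ)..t, L u.toNNReal := by
  rw [timeMeasure, setIntegral_map measurableSet_Ioc hL.aestronglyMeasurable
    measurable_real_toNNReal.aemeasurable, preimage_toNNReal_Ioc, NNReal.coe_zero,
    Measure.restrict_restrict measurableSet_Ioc,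
    Set.inter_eq_left.mpr (Set.Ioc_subset_Ioc_right (by exact_mod_cast ht)),
    intervalIntegral.integral_of_le t.coe_nonneg]

lemma integrableOn_jumpExpLeft (c : ℝ) (S : Finset ℝ≥0) (a : ℝ≥0 → ℝ) (T t : ℝ≥0) :
    Integrable (jumpExpLeft c S a) ((timeMeasure T).restrict (Set.Ioc 0 t)) := by
  refine Integrable.of_bound (measurable_jumpExpLeft c S a).aestronglyMeasurable
    (Real.exp (|c| * t) * ∏ s ∈ S, max |a s| 1) ?_
  filter_upwards [ae_restrict_mem measurableSet_Ioc] with s hs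
  exact abs_jumpExpLeft_le c S a hs.2

section Existence

variable {Ω : Type*} {mΩ : MeasurableSpace Ω} {𝓕 : Filtration ℝ≥0 mΩ} {P : Measure Ω} {T : ℝ≥0}
  {N : Ω → Measure (ℝ≥0 × ℝ)}

lemma IsPoissonRandomMeasure.measurable_restrict_Iic {ν : Measure ℝ}
    (hN : IsPoissonRandomMeasure 𝓕 P T ν N) (t : ℝ≥0) :
    Measurable[𝓕 t] fun ω => (N ω).restrict (Set.Iic t ×ˢ Set.univ) := by
  have hm : MeasurableSet (Set.Iic t ×ˢ (Set.univ : Set ℝ)) :=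
    measurableSet_Iic.prod MeasurableSet.univ
  refine @Measure.measurable_of_measurable_coe _ _ _ (𝓕 t) _ fun B hB => ?_
  simp_rw [Measure.restrict_apply hB]
  exact hN.adapted t _ (hB.inter hm) Set.inter_subset_right

lemma IsPoissonRandomMeasure.measurable_jumpProcess {ν : Measure ℝ}
    (hN : IsPoissonRandomMeasure 𝓕 P T ν N) (c : ℝ) {g : ℝ → ℝ} (hg : Measurable g) (t : ℝ≥0) :
    Measurable[𝓕 t] (jumpProcess c g N t) := by
  have h1 : Measurable (pointSum fun p => Real.log (g p.2)) :=
    measurable_pointSum (hg.comp measurable_snd).log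
  have h2 := h1.comp (hN.measurable_restrict_Iic t)
  exact Real.measurable_exp.comp (h2.const_add (c * t))

/-- On a path with finitely many points, the integral against N is the jump sum of `jumpExp_eq`, and
the compensator integral splits into a time integral and the mark integral c. -/
lemma exists_isAuxiliaryProcess [IsProbabilityMeasure P] {w : ℝ → ℝ}
    [IsFiniteMeasure (compensatorMeasure w)]
    (hN : IsPoissonRandomMeasure 𝓕 P T (compensatorMeasure w) N)
    (hcomplete : ∀ s, P s = 0 → MeasurableSet[𝓕 0] s)
    {β : ℝ≥0 → Ω → ℝ → ℝ} {g : ℝ → ℝ} (hβ : ∀ t ω ξ, β t ω ξ / w ξ = g ξ)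
    (hg : Measurable g) (hgint : Integrable g (compensatorMeasure w))
    {E : Set ℝ} (hE : MeasurableSet E) (hEnull : compensatorMeasure w Eᶜ = 0)
    (hEpos : ∀ ξ ∈ E, ξ ∈ marks ∧ 0 < g ξ) :
    ∃ Z, IsAuxiliaryProcess 𝓕 P T w N β Z ∧ ∀ᵐ ω ∂P, ∀ t, Z t ω =
      jumpProcess (∫ ξ, (1 - g ξ) ∂(compensatorMeasure w)) g N t ω := by
  classical
  set c := ∫ ξ, (1 - g ξ) ∂(compensatorMeasure w) with hc
  have hgood : ∀ᵐ ω ∂P, HasSimplePoints T E (N ω) := hN.ae_exists_eq_sum_dirac hE hEnull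
  -- Replacing the formula by 1 on the exceptional null set makes every path càdlàg; completeness
  -- puts that set into `𝓕 0`, so adaptedness survives.
  let Z : ℝ≥0 → Ω → ℝ := fun t ω =>
    if HasSimplePoints T E (N ω) then jumpProcess c g N t ω else 1
  have hZ : ∀ ω, HasSimplePoints T E (N ω) → ∃ (S : Finset ℝ≥0) (x : ℝ≥0 → ℝ),
      N ω = ∑ s ∈ S, Measure.dirac (s, x s) ∧ (∀ s ∈ S, s ∈ Set.Ioc 0 T ∧ x s ∈ E) ∧
      (fun t => Z t ω) = jumpExp c S fun s => g (x s) := by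
    intro ω hω
    obtain ⟨S, x, hSx, hS⟩ := id hω
    refine ⟨S, x, hSx, hS, funext fun t => ?_⟩
    rw [← jumpProcess_eq_jumpExp c hSx fun s hs => (hEpos _ (hS s hs).2).2]
    exact if_pos hω
  refine ⟨Z, ⟨fun t _ => ?_, fun ω => ?_, ?_⟩, ?_⟩
  · refine Measurable.ite ?_ (hN.measurable_jumpProcess c hg t) measurable_const
    have := (𝓕.mono (zero_le (a := t))) _ (hcomplete _ (ae_iff.mp hgood))
    have hcompl : {ω | HasSimplePoints T E (N ω)} = {ω | ¬HasSimplePoints T E (N ω)}ᶜ :=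
      Set.ext fun ω => not_not.symm
    rw [hcompl]
    exact this.compl
  · by_cases hω : HasSimplePoints T E (N ω)
    · obtain ⟨S, x, -, -, hZω⟩ := hZ ω hω
      rw [hZω]
      exact ⟨fun t _ => continuousWithinAt_jumpExp c S _ t,
        fun t _ => ⟨_, tendsto_jumpExp_left c S _ t⟩⟩
    · have hZω : (fun t => Z t ω) = fun _ => 1 := funext fun t => if_neg hω
      rw [hZω]
      exact ⟨fun t _ => continuousWithinAt_const, fun t _ => ⟨1, tendsto_const_nhds⟩⟩
  · filter_upwards [hgood] with ω hω t ht
    obtain ⟨S, x, hSx, hS, hZω⟩ := hZ ω hω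
    have hpos : ∀ s ∈ S, 0 < s := fun s hs => (hS s hs).1.1
    have hintegrand : auxiliaryIntegrand w β Z ω =
        fun p => jumpExpLeft c S (fun s => g (x s)) p.1 * (1 - g p.2) := by
      funext p
      rw [auxiliaryIntegrand, hβ, leftValue, hZω, leftLim_jumpExp c hpos]
    have hm : MeasurableSet (Set.Ioc 0 t ×ˢ marks) := measurableSet_Ioc.prod measurableSet_Ioi
    rw [hintegrand]
    refine ⟨?_, ?_, ?_⟩
    · rw [hSx]
      exact (integrable_sum_dirac _ S x).integrableOn
    · rw [IntegrableOn, intensity_restrict]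
      exact (integrableOn_jumpExpLeft c S _ T t).mul_prod
        ((integrable_const 1).sub hgint)
    · have h1 : ∫ p in Set.Ioc 0 t ×ˢ marks,
          jumpExpLeft c S (fun s => g (x s)) p.1 * (1 - g p.2) ∂(N ω) =
          ∑ s ∈ S, if s ≤ t then jumpExpLeft c S (fun s => g (x s)) s * (1 - g (x s)) else 0 := by
        rw [← integral_indicator hm, hSx, integral_sum_dirac]
        refine Finset.sum_congr rfl fun s hs => ?_
        by_cases hst : s ≤ t
        · rw [Set.indicator_of_mem (show (s, x s) ∈ Set.Ioc 0 t ×ˢ marks from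
            ⟨⟨hpos s hs, hst⟩, (hEpos _ (hS s hs).2).1⟩), if_pos hst]
        · rw [Set.indicator_of_notMem (fun h => hst h.1.2), if_neg hst]
      have h2 : ∫ p in Set.Ioc 0 t ×ˢ marks,
          jumpExpLeft c S (fun s => g (x s)) p.1 * (1 - g p.2)
            ∂(intensity T (compensatorMeasure w)) =
          c * ∫ u in (0 : ℝ)..t, jumpExpLeft c S (fun s => g (x s)) u.toNNReal := by
        rw [intensity_restrict, integral_prod_mul (jumpExpLeft c S fun s => g (x s))
          fun ξ => 1 - g ξ, setIntegral_timeMeasure ht (measurable_jumpExpLeft c S _), mul_comm]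
      rw [h1, h2, congrFun hZω t]
      exact jumpExp_eq c S hpos _ t
  · filter_upwards [hgood] with ω hω t
    exact if_pos hω

/-- The difference of two solutions solves the homogeneous equation. Taking absolute values merges
its two integrals into one against the sum of N(ω) and the intensity, where the Gronwall argument
applies. -/
lemma IsAuxiliaryProcess.ae_eq [IsProbabilityMeasure P] {w : ℝ → ℝ}
    [IsFiniteMeasure (compensatorMeasure w)]
    (hN : IsPoissonRandomMeasure 𝓕 P T (compensatorMeasure w) N)
    {β : ℝ≥0 → Ω → ℝ → ℝ} {g : ℝ → ℝ} (hβ : ∀ t ω ξ, β t ω ξ / w ξ = g ξ)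
    (hgint : Integrable g (compensatorMeasure w)) {Z Z' : ℝ≥0 → Ω → ℝ}
    (hZ : IsAuxiliaryProcess 𝓕 P T w N β Z) (hZ' : IsAuxiliaryProcess 𝓕 P T w N β Z') :
    ∀ᵐ ω ∂P, ∀ t ≤ T, Z t ω = Z' t ω := by
  filter_upwards [hZ.equation, hZ'.equation,
    hN.ae_exists_eq_sum_dirac MeasurableSet.univ (by simp)] with ω h1 h2 ⟨S, x, hSx, _⟩ t ht
  set D : ℝ≥0 → ℝ := fun t => Z t ω - Z' t ω with hD
  set f : ℝ → ℝ := fun ξ => 1 - g ξ with hf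
  set μ := intensity T (compensatorMeasure w) with hμ
  have hlim : ∀ t ≤ T, ∃ l, Tendsto D (𝓝[<] t) (𝓝 l) := by
    intro t ht
    obtain ⟨l, hl⟩ := (hZ.cadlag ω).2 t ht
    obtain ⟨l', hl'⟩ := (hZ'.cadlag ω).2 t ht
    exact ⟨l - l', hl.sub hl'⟩
  have hleft : ∀ t, 0 < t → t ≤ T → Function.leftLim D t = leftValue Z t ω - leftValue Z' t ω := by
    intro t h0 ht
    have := nhdsLT_neBot h0
    obtain ⟨l, hl⟩ := (hZ.cadlag ω).2 t ht
    obtain ⟨l', hl'⟩ := (hZ'.cadlag ω).2 t ht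
    rw [leftLim_eq_of_tendsto (hl.sub hl'), leftValue, leftValue, leftLim_eq_of_tendsto hl,
      leftLim_eq_of_tendsto hl']
  have hm : ∀ t : ℝ≥0, MeasurableSet (Set.Ioc 0 t ×ˢ marks) := fun t =>
    measurableSet_Ioc.prod measurableSet_Ioi
  have hdiff : ∀ t ≤ T, Set.EqOn
      (fun p => auxiliaryIntegrand w β Z ω p - auxiliaryIntegrand w β Z' ω p)
      (fun p => Function.leftLim D p.1 * f p.2) (Set.Ioc 0 t ×ˢ marks) := by
    intro t ht p hp
    simp only [auxiliaryIntegrand, hβ, hleft p.1 hp.1.1 (hp.1.2.trans ht), hf]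
    ring
  have hintN : ∀ t ≤ T, IntegrableOn (fun p => Function.leftLim D p.1 * f p.2)
      (Set.Ioc 0 t ×ˢ marks) (N ω) := fun t ht =>
    (((h1 t ht).1.sub (h2 t ht).1).congr_fun (hdiff t ht) (hm t))
  have hintμ : ∀ t ≤ T, IntegrableOn (fun p => Function.leftLim D p.1 * f p.2)
      (Set.Ioc 0 t ×ˢ marks) μ := fun t ht =>
    (((h1 t ht).2.1.sub (h2 t ht).2.1).congr_fun (hdiff t ht) (hm t))
  have hfμ : Integrable (fun p : ℝ≥0 × ℝ => f p.2) μ :=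
    ((integrable_const 1).sub hgint).comp_snd (timeMeasure T)
  have hzero := eq_zero_of_abs_le_setIntegral (N ω + μ) marks measurableSet_Ioi f
    (Integrable.add_measure (by rw [hSx]; exact integrable_sum_dirac _ S x) hfμ) T D hlim
    (IntegrableOn.add_measure (hintN T le_rfl) (hintμ T le_rfl)) (fun t ht => ?_) t ht
  · exact sub_eq_zero.mp hzero
  · have hDt : D t = -(∫ p in Set.Ioc 0 t ×ˢ marks, Function.leftLim D p.1 * f p.2 ∂(N ω)) +
        ∫ p in Set.Ioc 0 t ×ˢ marks, Function.leftLim D p.1 * f p.2 ∂μ := by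
      rw [← setIntegral_congr_fun (hm t) (hdiff t ht), ← setIntegral_congr_fun (hm t) (hdiff t ht),
        integral_sub (h1 t ht).1 (h2 t ht).1, integral_sub (h1 t ht).2.1 (h2 t ht).2.1]
      simp only [hD]
      rw [(h1 t ht).2.2, (h2 t ht).2.2]
      ring
    rw [Measure.restrict_add, integral_add_measure (hintN t ht).abs (hintμ t ht).abs, hDt]
    refine (abs_add_le _ _).trans ?_
    rw [abs_neg]
    exact add_le_add abs_integral_le_integral_abs abs_integral_le_integral_abs

end Existence

section Moments

/-! ### Moments and the martingale property of the stochastic exponential -/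

/-- A bound for `jumpProcess` on `[0, T]` that does not depend on the time. -/
def jumpBound {Ω : Type*} (c : ℝ) (T : ℝ≥0) (g : ℝ → ℝ) (N : Ω → Measure (ℝ≥0 × ℝ)) (ω : Ω) : ℝ :=
  Real.exp (|c| * T) * Real.exp (pointSum (fun p => max (Real.log (g p.2)) 0) (N ω))

lemma exp_max_log {y : ℝ} (hy : 0 < y) : Real.exp (max (Real.log y) 0) = max |y| 1 := by
  rw [Real.exp_monotone.map_max, Real.exp_log hy, Real.exp_zero, abs_of_pos hy]

lemma jumpBound_eq {Ω : Type*} (c : ℝ) (T : ℝ≥0) {g : ℝ → ℝ} {N : Ω → Measure (ℝ≥0 × ℝ)} {ω : Ω}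
    {S : Finset ℝ≥0} {x : ℝ≥0 → ℝ} (hSx : N ω = ∑ s ∈ S, Measure.dirac (s, x s))
    (hg : ∀ s ∈ S, 0 < g (x s)) :
    jumpBound c T g N ω = Real.exp (|c| * T) * ∏ s ∈ S, max |g (x s)| 1 := by
  rw [jumpBound, hSx, pointSum_sum_dirac, Real.exp_sum]
  congr 1
  exact Finset.prod_congr rfl fun s hs => exp_max_log (hg s hs)

/-- The growth factor of `jumpProcess` over `(s, t]`. -/
def jumpRatio {Ω : Type*} (c : ℝ) (g : ℝ → ℝ) (N : Ω → Measure (ℝ≥0 × ℝ)) (s t : ℝ≥0) (ω : Ω) : ℝ :=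
  Real.exp (c * (t - s)) *
    Real.exp (pointSum (fun p => Real.log (g p.2)) ((N ω).restrict (Set.Ioc s t ×ˢ Set.univ)))

variable {Ω : Type*} {mΩ : MeasurableSpace Ω} {𝓕 : Filtration ℝ≥0 mΩ} {P : Measure Ω} {T : ℝ≥0}
  {N : Ω → Measure (ℝ≥0 × ℝ)} {ν : Measure ℝ} {g : ℝ → ℝ}

lemma measurable_jumpBound (hN : IsPoissonRandomMeasure 𝓕 P T ν N) (c : ℝ) (hg : Measurable g) :
    Measurable (jumpBound c T g N) :=
  (((measurable_pointSum ((hg.comp measurable_snd).log.max measurable_const)).comp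
    hN.measurable).exp).const_mul _

/-- No sign condition is needed because `Real.log` depends on |y| and vanishes at 0; hence the
moment bound below does not require g to be positive. -/
lemma exp_two_mul_max_log_le (y : ℝ) : Real.exp (2 * max (Real.log y) 0) ≤ y ^ 2 + 1 := by
  rcases eq_or_ne y 0 with rfl | hy
  · simp
  rcases max_cases (Real.log y) 0 with ⟨h, _⟩ | ⟨h, _⟩ <;> rw [h]
  · rw [two_mul, Real.exp_add, Real.exp_log_eq_abs hy, abs_mul_abs_self]
    nlinarith
  · rw [mul_zero, Real.exp_zero]
    nlinarith

/-- The exponential formula for 2 max(log g, 0). The function g is not tied to ν, so the bound is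
available under P_k with ν_k and also under P_C with ν_C. -/
lemma lintegral_jumpBound_sq_lt_top [IsProbabilityMeasure P] [IsFiniteMeasure ν]
    (hN : IsPoissonRandomMeasure 𝓕 P T ν N) (c : ℝ) (hg : Measurable g)
    (hg2 : Integrable (fun ξ => g ξ ^ 2) ν) :
    ∫⁻ ω, ENNReal.ofReal (jumpBound c T g N ω ^ 2) ∂P < ∞ := by
  have hm : Measurable fun p : ℝ≥0 × ℝ => 2 * max (Real.log (g p.2)) 0 :=
    ((hg.comp measurable_snd).log.max measurable_const).const_mul 2
  have hint : Integrable (fun p : ℝ≥0 × ℝ => Real.exp (2 * max (Real.log (g p.2)) 0))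
      (intensity T ν) := by
    refine ((hg2.add (integrable_const 1)).comp_snd (timeMeasure T)).mono'
      hm.exp.aestronglyMeasurable (ae_of_all _ fun p => ?_)
    rw [Real.norm_eq_abs, Real.abs_exp]
    exact exp_two_mul_max_log_le _
  have heq : ∀ᵐ ω ∂P, ENNReal.ofReal (jumpBound c T g N ω ^ 2) =
      ENNReal.ofReal (Real.exp (|c| * T) ^ 2) *
        ENNReal.ofReal (Real.exp (pointSum (fun p => 2 * max (Real.log (g p.2)) 0) (N ω))) := by
    filter_upwards [hN.ae_exists_eq_sum_dirac MeasurableSet.univ (by simp)] with ω ⟨S, x, hSx, _⟩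
    rw [← ENNReal.ofReal_mul (by positivity), jumpBound, mul_pow, ← Real.exp_nat_mul (pointSum _ _),
      hSx, pointSum_sum_dirac, pointSum_sum_dirac, Finset.mul_sum]
    norm_num
  rw [lintegral_congr_ae heq, lintegral_const_mul' _ _ ENNReal.ofReal_ne_top]
  refine ENNReal.mul_lt_top ENNReal.ofReal_lt_top ?_
  rw [hN.lintegral_exp_pointSum hm hint]
  exact ENNReal.ofReal_lt_top

lemma memLp_jumpBound [IsProbabilityMeasure P] [IsFiniteMeasure ν]
    (hN : IsPoissonRandomMeasure 𝓕 P T ν N) (c : ℝ) (hg : Measurable g)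
    (hg2 : Integrable (fun ξ => g ξ ^ 2) ν) : MemLp (jumpBound c T g N) 2 P := by
  have hm := measurable_jumpBound hN c hg
  rw [memLp_two_iff_integrable_sq hm.aestronglyMeasurable]
  refine ⟨(hm.pow_const 2).aestronglyMeasurable, ?_⟩
  rw [hasFiniteIntegral_iff_ofReal (ae_of_all _ fun ω => sq_nonneg _)]
  exact lintegral_jumpBound_sq_lt_top hN c hg hg2

/-- The growth factor involves only the points in (s, t]; being measurable for the points after s,
it is independent of `𝓕 s`. -/
lemma jumpRatio_measurable_future (c : ℝ) (hg : Measurable g) (s t : ℝ≥0) :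
    Measurable[⨆ (B : Set (ℝ≥0 × ℝ)) (_ : MeasurableSet B ∧ B ⊆ Set.Ioi s ×ˢ Set.univ),
        MeasurableSpace.comap (fun ω => N ω B) inferInstance] (jumpRatio c g N s t) := by
  have hm : MeasurableSet (Set.Ioc s t ×ˢ (Set.univ : Set ℝ)) :=
    measurableSet_Ioc.prod MeasurableSet.univ
  have h1 : Measurable (pointSum fun p => Real.log (g p.2)) :=
    measurable_pointSum (hg.comp measurable_snd).log
  set m : MeasurableSpace Ω :=
    ⨆ (B : Set (ℝ≥0 × ℝ)) (_ : MeasurableSet B ∧ B ⊆ Set.Ioi s ×ˢ Set.univ),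
        MeasurableSpace.comap (fun ω => N ω B) inferInstance with hmdef
  have h2 : Measurable[m] fun ω => (N ω).restrict (Set.Ioc s t ×ˢ Set.univ) := by
    refine @Measure.measurable_of_measurable_coe _ _ _ m _ fun B hB => ?_
    simp_rw [Measure.restrict_apply hB]
    have hle : MeasurableSpace.comap (fun ω => N ω (B ∩ Set.Ioc s t ×ˢ Set.univ)) inferInstance ≤ m :=
      le_iSup₂_of_le (f := fun (B : Set (ℝ≥0 × ℝ))
        (_ : MeasurableSet B ∧ B ⊆ Set.Ioi s ×ˢ Set.univ) =>
        MeasurableSpace.comap (fun ω => N ω B) inferInstance) _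
        ⟨hB.inter hm, Set.inter_subset_right.trans
          (Set.prod_mono Set.Ioc_subset_Ioi_self le_rfl)⟩ le_rfl
    exact (comap_measurable _).mono hle le_rfl
  exact ((Real.measurable_exp.comp (h1.comp h2))).const_mul _

/-- The exponential formula produces exp((t - s) ∫ (g - 1) dν), which the drift with c = ∫ (1 - g)
dν cancels exactly. -/
lemma lintegral_jumpRatio [IsProbabilityMeasure P] [IsFiniteMeasure ν]
    (hN : IsPoissonRandomMeasure 𝓕 P T ν N) (hg : Measurable g) (hgint : Integrable g ν)
    (hgpos : ∀ᵐ ξ ∂ν, 0 < g ξ) {s t : ℝ≥0} (hst : s ≤ t) (ht : t ≤ T) :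
    ∫⁻ ω, ENNReal.ofReal (jumpRatio (∫ ξ, (1 - g ξ) ∂ν) g N s t ω) ∂P = 1 := by
  set A : Set (ℝ≥0 × ℝ) := Set.Ioc s t ×ˢ Set.univ with hA
  have hAm : MeasurableSet A := measurableSet_Ioc.prod MeasurableSet.univ
  set h : ℝ≥0 × ℝ → ℝ := A.indicator fun p => Real.log (g p.2) with hh
  have hhm : Measurable h := (hg.comp measurable_snd).log.indicator hAm
  have hpos : ∀ᵐ p ∂(intensity T ν), 0 < g p.2 :=
    Measure.quasiMeasurePreserving_snd.ae hgpos
  have hexp : ∀ᵐ p ∂(intensity T ν), Real.exp (h p) - 1 = A.indicator (fun p => g p.2 - 1) p := by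
    filter_upwards [hpos] with p hp
    by_cases hpA : p ∈ A
    · rw [hh, Set.indicator_of_mem hpA, Set.indicator_of_mem hpA, Real.exp_log hp]
    · rw [hh, Set.indicator_of_notMem hpA, Set.indicator_of_notMem hpA, Real.exp_zero, sub_self]
  have hg1 : Integrable (fun p : ℝ≥0 × ℝ => g p.2 - 1) (intensity T ν) :=
    (hgint.sub (integrable_const 1)).comp_snd (timeMeasure T)
  have hint : Integrable (fun p => Real.exp (h p)) (intensity T ν) := by
    refine ((hg1.indicator hAm).add (integrable_const 1)).congr ?_
    filter_upwards [hexp] with p hp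
    rw [Pi.add_apply, ← hp, sub_add_cancel]
  have hval : ∫ p, (Real.exp (h p) - 1) ∂(intensity T ν) = (t - s) * ∫ ξ, (g ξ - 1) ∂ν := by
    rw [integral_congr_ae hexp, integral_indicator hAm, intensity, hA, ← Measure.prod_restrict,
      Measure.restrict_univ]
    have := integral_prod_mul (μ := (timeMeasure T).restrict (Set.Ioc s t)) (ν := ν)
      (fun _ : ℝ≥0 => (1 : ℝ)) fun ξ => g ξ - 1
    simp only [one_mul] at this
    rw [this, integral_const, smul_eq_mul, mul_one, measureReal_restrict_apply MeasurableSet.univ,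
      Set.univ_inter, measureReal_def, timeMeasure_Ioc ht,
      ENNReal.toReal_ofReal (sub_nonneg.mpr (by exact_mod_cast hst))]
  have hneg : ∫ ξ, (1 - g ξ) ∂ν = -∫ ξ, (g ξ - 1) ∂ν := by
    rw [← integral_neg]
    simp
  have heq : ∀ ω, ENNReal.ofReal (jumpRatio (∫ ξ, (1 - g ξ) ∂ν) g N s t ω) =
      ENNReal.ofReal (Real.exp ((∫ ξ, (1 - g ξ) ∂ν) * (t - s))) *
        ENNReal.ofReal (Real.exp (pointSum h (N ω))) := by
    intro ω
    rw [jumpRatio, pointSum_restrict _ _ hAm, ENNReal.ofReal_mul (Real.exp_pos _).le]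
  simp_rw [heq]
  rw [lintegral_const_mul' _ _ ENNReal.ofReal_ne_top, hN.lintegral_exp_pointSum hhm hint, hval,
    ← ENNReal.ofReal_mul (Real.exp_pos _).le, ← Real.exp_add, hneg]
  simp [mul_comm]

lemma measurable_jumpRatio (hN : IsPoissonRandomMeasure 𝓕 P T ν N) (c : ℝ) (hg : Measurable g)
    (s t : ℝ≥0) : Measurable (jumpRatio c g N s t) := by
  refine (jumpRatio_measurable_future c hg s t).mono ?_ le_rfl
  exact iSup₂_le fun B hB => (hN.measurable_apply hB.1).comap_le

lemma integrable_jumpRatio [IsProbabilityMeasure P] [IsFiniteMeasure ν]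
    (hN : IsPoissonRandomMeasure 𝓕 P T ν N) (hg : Measurable g) (hgint : Integrable g ν)
    (hgpos : ∀ᵐ ξ ∂ν, 0 < g ξ) {s t : ℝ≥0} (hst : s ≤ t) (ht : t ≤ T) :
    Integrable (jumpRatio (∫ ξ, (1 - g ξ) ∂ν) g N s t) P := by
  refine ⟨(measurable_jumpRatio hN _ hg s t).aestronglyMeasurable, ?_⟩
  rw [hasFiniteIntegral_iff_ofReal (ae_of_all _ fun ω => by rw [jumpRatio]; positivity),
    lintegral_jumpRatio hN hg hgint hgpos hst ht]
  exact ENNReal.one_lt_top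

lemma integral_jumpRatio [IsProbabilityMeasure P] [IsFiniteMeasure ν]
    (hN : IsPoissonRandomMeasure 𝓕 P T ν N) (hg : Measurable g) (hgint : Integrable g ν)
    (hgpos : ∀ᵐ ξ ∂ν, 0 < g ξ) {s t : ℝ≥0} (hst : s ≤ t) (ht : t ≤ T) :
    ∫ ω, jumpRatio (∫ ξ, (1 - g ξ) ∂ν) g N s t ω ∂P = 1 := by
  rw [integral_eq_lintegral_of_nonneg_ae
    (ae_of_all _ fun ω => by rw [jumpRatio]; exact (mul_pos (Real.exp_pos _) (Real.exp_pos _)).le)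
    (measurable_jumpRatio hN _ hg s t).aestronglyMeasurable,
    lintegral_jumpRatio hN hg hgint hgpos hst ht, ENNReal.toReal_one]

lemma jumpProcess_mul_jumpRatio (c : ℝ) {ω : Ω} {S : Finset ℝ≥0} {x : ℝ≥0 → ℝ}
    (hSx : N ω = ∑ s ∈ S, Measure.dirac (s, x s)) {s t : ℝ≥0} (hst : s ≤ t) :
    jumpProcess c g N t ω = jumpProcess c g N s ω * jumpRatio c g N s t ω := by
  have hIic : ∀ u : ℝ≥0, MeasurableSet (Set.Iic u ×ˢ (Set.univ : Set ℝ)) := fun u =>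
    measurableSet_Iic.prod MeasurableSet.univ
  rw [jumpProcess, jumpProcess, jumpRatio, ← Real.exp_add, ← Real.exp_add,
    pointSum_restrict _ _ (hIic t), pointSum_restrict _ _ (hIic s),
    pointSum_restrict _ _ (measurableSet_Ioc.prod MeasurableSet.univ), hSx]
  simp only [pointSum_sum_dirac]
  have hsplit : Set.Iic t ×ˢ (Set.univ : Set ℝ) =
      Set.Iic s ×ˢ Set.univ ∪ Set.Ioc s t ×ˢ Set.univ := by
    rw [← Set.union_prod, Set.Iic_union_Ioc_eq_Iic hst]
  have hdisj : Disjoint (Set.Iic s ×ˢ (Set.univ : Set ℝ)) (Set.Ioc s t ×ˢ Set.univ) :=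
    Set.disjoint_left.mpr fun p h1 h2 => absurd h1.1 (not_le.mpr h2.1.1)
  rw [hsplit, Set.indicator_union_of_disjoint hdisj, Finset.sum_add_distrib]
  congr 1
  ring

section Solution

variable [IsProbabilityMeasure P] [IsFiniteMeasure ν] {Z : ℝ≥0 → Ω → ℝ} {E : Set ℝ}

lemma ae_abs_le_jumpBound (hN : IsPoissonRandomMeasure 𝓕 P T ν N) (hE : MeasurableSet E)
    (hEnull : ν Eᶜ = 0) (hEpos : ∀ ξ ∈ E, 0 < g ξ) {c : ℝ}
    (hZ : ∀ᵐ ω ∂P, ∀ t ≤ T, Z t ω = jumpProcess c g N t ω) :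
    ∀ᵐ ω ∂P, ∀ t ≤ T, |Z t ω| ≤ jumpBound c T g N ω := by
  filter_upwards [hZ, hN.ae_exists_eq_sum_dirac hE hEnull] with ω h1 ⟨S, x, hSx, hS⟩ t ht
  have hpos : ∀ s ∈ S, 0 < g (x s) := fun s hs => hEpos _ (hS s hs).2
  rw [h1 t ht, jumpProcess_eq_jumpExp c hSx hpos, jumpBound_eq c T hSx hpos]
  exact abs_jumpExp_le c S _ ht

lemma abs_leftValue_le {T : ℝ≥0} (hcad : IsCadlag T Z) {ω : Ω} {U : ℝ}
    (hU : ∀ t ≤ T, |Z t ω| ≤ U) : ∀ t ≤ T, |leftValue Z t ω| ≤ U := by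
  intro t ht
  rcases eq_or_ne t 0 with rfl | h0
  · rw [leftValue, leftLim_eq_of_eq_bot _ nhdsLT_zero_eq_bot]
    exact hU 0 ht
  · have := nhdsLT_neBot (pos_iff_ne_zero.mpr h0)
    obtain ⟨l, hl⟩ := (hcad ω).2 t ht
    rw [leftValue, leftLim_eq_of_tendsto hl]
    exact le_of_tendsto hl.abs (eventually_of_mem self_mem_nhdsWithin
      fun u hu => hU u (le_of_lt (lt_of_lt_of_le hu ht)))

lemma memLp_of_ae_eq_jumpProcess (hN : IsPoissonRandomMeasure 𝓕 P T ν N) (hE : MeasurableSet E)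
    (hEnull : ν Eᶜ = 0) (hEpos : ∀ ξ ∈ E, 0 < g ξ) (hg : Measurable g)
    (hg2 : Integrable (fun ξ => g ξ ^ 2) ν) {c : ℝ}
    (hZ : ∀ᵐ ω ∂P, ∀ t ≤ T, Z t ω = jumpProcess c g N t ω)
    (hadapted : ∀ t ≤ T, Measurable[𝓕 t] (Z t)) {t : ℝ≥0} (ht : t ≤ T) :
    MemLp (Z t) 2 P := by
  refine (memLp_jumpBound hN c hg hg2).mono'
    ((hadapted t ht).mono (𝓕.le t) le_rfl).aestronglyMeasurable ?_
  filter_upwards [ae_abs_le_jumpBound hN hE hEnull hEpos hZ] with ω hω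
  exact hω t ht

/-- Write Z_t as Z_s times the growth factor over (s, t], pull out Z_s, and use that the factor is
independent of the past with mean one. -/
lemma condExp_of_ae_eq_jumpProcess (hN : IsPoissonRandomMeasure 𝓕 P T ν N) (hE : MeasurableSet E)
    (hEnull : ν Eᶜ = 0) (hEpos : ∀ ξ ∈ E, 0 < g ξ) (hg : Measurable g) (hgint : Integrable g ν)
    (hg2 : Integrable (fun ξ => g ξ ^ 2) ν)
    (hZ : ∀ᵐ ω ∂P, ∀ t ≤ T, Z t ω = jumpProcess (∫ ξ, (1 - g ξ) ∂ν) g N t ω)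
    (hadapted : ∀ t ≤ T, Measurable[𝓕 t] (Z t)) {s t : ℝ≥0} (hst : s ≤ t) (ht : t ≤ T) :
    P[Z t | 𝓕 s] =ᵐ[P] Z s := by
  set c := ∫ ξ, (1 - g ξ) ∂ν with hc
  have hgpos : ∀ᵐ ξ ∂ν, 0 < g ξ := by
    filter_upwards [measure_eq_zero_iff_ae_notMem.mp hEnull] with ξ hξ
    exact hEpos ξ (not_not.mp hξ)
  have hprod : Z t =ᵐ[P] Z s * jumpRatio c g N s t := by
    filter_upwards [hZ, hN.ae_exists_eq_sum_dirac hE hEnull] with ω h1 ⟨S, x, hSx, hS⟩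
    rw [Pi.mul_apply, h1 t ht, h1 s (hst.trans ht), jumpProcess_mul_jumpRatio c hSx hst]
  have hRint := integrable_jumpRatio hN hg hgint hgpos hst ht
  have hZint : Integrable (Z t) P :=
    (memLp_of_ae_eq_jumpProcess hN hE hEnull hEpos hg hg2 hZ hadapted ht).integrable one_le_two
  have h1 : P[Z s * jumpRatio c g N s t | 𝓕 s] =ᵐ[P] Z s * P[jumpRatio c g N s t | 𝓕 s] :=
    condExp_mul_of_stronglyMeasurable_left (hadapted s (hst.trans ht)).stronglyMeasurable
      (hZint.congr hprod) hRint
  have h2 : P[jumpRatio c g N s t | 𝓕 s] =ᵐ[P] fun _ => P[jumpRatio c g N s t] :=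
    condExp_indep_eq (iSup₂_le fun B hB => (hN.measurable_apply hB.1).comap_le) (𝓕.le s)
      (jumpRatio_measurable_future c hg s t).stronglyMeasurable (hN.indep_past s)
  refine (condExp_congr_ae hprod).trans (h1.trans ?_)
  filter_upwards [h2] with ω hω
  rw [Pi.mul_apply, hω, integral_jumpRatio hN hg hgint hgpos hst ht, mul_one]

lemma martingale_of_ae_eq_jumpProcess (hN : IsPoissonRandomMeasure 𝓕 P T ν N)
    (hE : MeasurableSet E) (hEnull : ν Eᶜ = 0) (hEpos : ∀ ξ ∈ E, 0 < g ξ) (hg : Measurable g)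
    (hgint : Integrable g ν) (hg2 : Integrable (fun ξ => g ξ ^ 2) ν)
    (hZ : ∀ᵐ ω ∂P, ∀ t ≤ T, Z t ω = jumpProcess (∫ ξ, (1 - g ξ) ∂ν) g N t ω)
    (hadapted : ∀ t ≤ T, Measurable[𝓕 t] (Z t)) :
    Martingale (fun t => Z (min t T)) 𝓕 P := by
  refine ⟨fun t => ((hadapted _ (min_le_right t T)).mono (𝓕.mono (min_le_left t T))
    le_rfl).stronglyMeasurable, fun s t hst => ?_⟩
  change P[Z (min t T) | 𝓕 s] =ᵐ[P] Z (min s T)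
  rcases le_total s T with hs | hs
  · rw [min_eq_left hs]
    exact condExp_of_ae_eq_jumpProcess hN hE hEnull hEpos hg hgint hg2 hZ hadapted
      (le_min hst hs) (min_le_right t T)
  · rw [min_eq_right hs, min_eq_right (hs.trans hst)]
    rw [condExp_of_stronglyMeasurable (𝓕.le s)
      ((hadapted T le_rfl).mono (𝓕.mono hs) le_rfl).stronglyMeasurable
      ((memLp_of_ae_eq_jumpProcess hN hE hEnull hEpos hg hg2 hZ hadapted
        le_rfl).integrable one_le_two)]

lemma integral_of_ae_eq_jumpProcess (hN : IsPoissonRandomMeasure 𝓕 P T ν N)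
    (hE : MeasurableSet E) (hEnull : ν Eᶜ = 0) (hEpos : ∀ ξ ∈ E, 0 < g ξ) (hg : Measurable g)
    (hgint : Integrable g ν)
    (hZ : ∀ᵐ ω ∂P, ∀ t ≤ T, Z t ω = jumpProcess (∫ ξ, (1 - g ξ) ∂ν) g N t ω) :
    ∫ ω, Z T ω ∂P = 1 := by
  have hgpos : ∀ᵐ ξ ∂ν, 0 < g ξ := by
    filter_upwards [measure_eq_zero_iff_ae_notMem.mp hEnull] with ξ hξ
    exact hEpos ξ (not_not.mp hξ)
  rw [← integral_jumpRatio hN hg hgint hgpos (zero_le (a := T)) le_rfl]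
  refine integral_congr_ae ?_
  filter_upwards [hZ, hN.ae_exists_eq_sum_dirac hE hEnull] with ω h1 ⟨S, x, hSx, hS⟩
  have h0 : jumpProcess (∫ ξ, (1 - g ξ) ∂ν) g N 0 ω = 1 := by
    rw [jumpProcess_eq_jumpExp _ hSx fun s hs => hEpos _ (hS s hs).2, jumpExp,
      Finset.prod_eq_one fun s hs => if_neg (not_le.mpr (hS s hs).1.1)]
    simp
  rw [h1 T le_rfl, jumpProcess_mul_jumpRatio _ hSx (zero_le (a := T)), h0, one_mul]

end Solution

end Moments

/-! ### Integrability with respect to the compensator measures -/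

lemma integrable_compensatorMeasure_iff {w : ℝ → ℝ} (hw : Measurable w)
    (hw0 : ∀ ξ ∈ marks, 0 ≤ w ξ) {h : ℝ → ℝ} :
    Integrable h (compensatorMeasure w) ↔ IntegrableOn (fun ξ => w ξ * h ξ) marks := by
  rw [compensatorMeasure, integrable_withDensity_iff_integrable_smul' hw.ennreal_ofReal
    (ae_of_all _ fun _ => ENNReal.ofReal_lt_top), IntegrableOn]
  refine integrable_congr ?_
  filter_upwards [ae_restrict_mem measurableSet_Ioi] with ξ hξ
  rw [ENNReal.toReal_ofReal (hw0 ξ hξ), smul_eq_mul]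

lemma isFiniteMeasure_compensatorMeasure {w : ℝ → ℝ} (hw : Measurable w)
    (hw0 : ∀ ξ ∈ marks, 0 ≤ w ξ) (hint : IntegrableOn w marks) :
    IsFiniteMeasure (compensatorMeasure w) := by
  have h1 : Integrable (fun _ => (1 : ℝ)) (compensatorMeasure w) :=
    (integrable_compensatorMeasure_iff hw hw0).mpr (by simpa using hint)
  exact (integrable_const_iff_isFiniteMeasure one_ne_zero).mp h1

lemma compensatorMeasure_setOf_nonpos {w : ℝ → ℝ} (hw : Measurable w) :
    compensatorMeasure w {ξ | w ξ ≤ 0} = 0 := by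
  rw [compensatorMeasure, withDensity_apply _ (measurableSet_le hw measurable_const)]
  refine (setLIntegral_congr_fun (measurableSet_le hw measurable_const)
    fun ξ hξ => ENNReal.ofReal_of_nonpos hξ).trans ?_
  simp

/-- The jump factor `(1 + η) v_C / v_k`. -/
def jumpFactor (η : ℝ) (vC vk : ℝ → ℝ) (ξ : ℝ) : ℝ := (1 + η) * (vC ξ / vk ξ)

lemma measurable_jumpFactor (η : ℝ) {vC vk : ℝ → ℝ} (hC : Measurable vC) (hk : Measurable vk) :
    Measurable (jumpFactor η vC vk) :=
  (hC.div hk).const_mul _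

lemma integrable_of_integrable_sq {ν : Measure ℝ} [IsFiniteMeasure ν] {g : ℝ → ℝ}
    (hg : Measurable g) (hg2 : Integrable (fun ξ => g ξ ^ 2) ν) : Integrable g ν :=
  ((memLp_two_iff_integrable_sq hg.aestronglyMeasurable).mpr hg2).integrable one_le_two

lemma integrable_one_sub_sq {ν : Measure ℝ} [IsFiniteMeasure ν] {g : ℝ → ℝ}
    (hg : Measurable g) (hg2 : Integrable (fun ξ => g ξ ^ 2) ν) :
    Integrable (fun ξ => (1 - g ξ) ^ 2) ν := by
  refine ((hg2.const_mul 2).add (integrable_const 2)).mono'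
    ((hg.const_sub 1).pow_const 2).aestronglyMeasurable (ae_of_all _ fun ξ => ?_)
  rw [Real.norm_of_nonneg (sq_nonneg _)]
  simp only [Pi.add_apply]
  -- Here 2g² + 2 - (1 - g)² = (1 + g)².
  nlinarith [sq_nonneg (1 + g ξ)]

lemma squareIntegrableField_of_const {Ω : Type*} {mΩ : MeasurableSpace Ω} (P : Measure Ω)
    [IsFiniteMeasure P] (T : ℝ≥0) {ν : Measure ℝ} {h : ℝ → ℝ}
    (hh : Integrable (fun ξ => h ξ ^ 2) ν) : SquareIntegrableField P T ν fun _ _ ξ => h ξ := by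
  have h1 : ∫⁻ ξ, ENNReal.ofReal (h ξ ^ 2) ∂ν < ∞ := by
    have := hh.2
    rwa [hasFiniteIntegral_iff_ofReal (ae_of_all _ fun ξ => sq_nonneg _)] at this
  rw [SquareIntegrableField, lintegral_const, lintegral_const]
  exact ENNReal.mul_lt_top (ENNReal.mul_lt_top h1 (measure_lt_top _ _)) (measure_lt_top _ _)

/-- The bound is free of time and is a sum of products of a function of ω and a function of ξ, so
the iterated integral factorises; no joint measurability of φ is needed. -/
lemma squareIntegrableField_of_le {Ω : Type*} {mΩ : MeasurableSpace Ω} {ι : Type*} [Fintype ι]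
    (P : Measure Ω) [IsFiniteMeasure P] (T : ℝ≥0) {ν : Measure ℝ} {q₀ : ℝ → ℝ} {q : ι → ℝ → ℝ}
    {U : ι → Ω → ℝ} (hq₀ : Integrable q₀ ν) (hq₀m : Measurable q₀) (hq₀0 : ∀ ξ, 0 ≤ q₀ ξ)
    (hq : ∀ k, Integrable (q k) ν)
    (hqm : ∀ k, Measurable (q k)) (hq0 : ∀ k ξ, 0 ≤ q k ξ) (hU : ∀ k, Measurable (U k))
    (hU2 : ∀ k, ∫⁻ ω, ENNReal.ofReal (U k ω ^ 2) ∂P < ∞) {φ : ℝ≥0 → Ω → ℝ → ℝ}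
    (hφ : ∀ᵐ ω ∂P, ∀ t ≤ T, ∀ ξ, φ t ω ξ ^ 2 ≤ q₀ ξ + ∑ k, U k ω ^ 2 * q k ξ) :
    SquareIntegrableField P T ν φ := by
  have hfin : ∀ h : ℝ → ℝ, Integrable h ν → (∀ ξ, 0 ≤ h ξ) →
      ∫⁻ ξ, ENNReal.ofReal (h ξ) ∂ν < ∞ := by
    intro h hh h0
    have := hh.2
    rwa [hasFiniteIntegral_iff_ofReal (ae_of_all _ h0)] at this
  set I₀ := ∫⁻ ξ, ENNReal.ofReal (q₀ ξ) ∂ν with hI₀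
  set I : ι → ℝ≥0∞ := fun k => ∫⁻ ξ, ENNReal.ofReal (q k ξ) ∂ν with hI
  have hinner : ∀ᵐ ω ∂P, ∫⁻ s, (∫⁻ ξ, ENNReal.ofReal (φ s ω ξ ^ 2) ∂ν) ∂(timeMeasure T) ≤
      (I₀ + ∑ k, ENNReal.ofReal (U k ω ^ 2) * I k) * timeMeasure T Set.univ := by
    filter_upwards [hφ] with ω hω
    rw [← lintegral_const]
    refine lintegral_mono_ae ?_
    filter_upwards [ae_timeMeasure_mem T] with s hs
    calc ∫⁻ ξ, ENNReal.ofReal (φ s ω ξ ^ 2) ∂ν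
        ≤ ∫⁻ ξ, (ENNReal.ofReal (q₀ ξ) +
            ∑ k, ENNReal.ofReal (U k ω ^ 2) * ENNReal.ofReal (q k ξ)) ∂ν := by
          refine lintegral_mono fun ξ => ?_
          refine (ENNReal.ofReal_le_ofReal (hω s hs.2 ξ)).trans_eq ?_
          rw [ENNReal.ofReal_add (hq₀0 ξ)
            (Finset.sum_nonneg fun k _ => mul_nonneg (sq_nonneg _) (hq0 k ξ)),
            ENNReal.ofReal_sum_of_nonneg fun k _ => mul_nonneg (sq_nonneg _) (hq0 k ξ)]
          simp_rw [ENNReal.ofReal_mul (sq_nonneg _)]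
      _ = I₀ + ∑ k, ENNReal.ofReal (U k ω ^ 2) * I k := by
          rw [lintegral_add_left hq₀m.ennreal_ofReal,
            lintegral_finsetSum _ fun k _ => ((hqm k).ennreal_ofReal).const_mul _]
          congr 1
          exact Finset.sum_congr rfl fun k _ =>
            lintegral_const_mul' _ _ ENNReal.ofReal_ne_top
  refine (lintegral_mono_ae hinner).trans_lt ?_
  rw [lintegral_mul_const' _ _ (measure_ne_top _ _), lintegral_add_left measurable_const,
    lintegral_finsetSum _ fun k _ => (((hU k).pow_const 2).ennreal_ofReal).mul_const _,
    lintegral_const]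
  refine ENNReal.mul_lt_top (ENNReal.add_lt_top.mpr ⟨?_, ?_⟩) (measure_lt_top _ _)
  · exact ENNReal.mul_lt_top (hfin _ hq₀ hq₀0) (measure_lt_top _ _)
  · refine ENNReal.sum_lt_top.mpr fun k _ => ?_
    rw [lintegral_mul_const' _ _ (hfin _ (hq k) (hq0 k)).ne]
    exact ENNReal.mul_lt_top (hU2 k) (hfin _ (hq k) (hq0 k))

/-! ### The candidate strategy -/

lemma abs_ell_le (η : ℝ) (vC vk : ℝ → ℝ) {t T : ℝ≥0} :
    |ell η vC vk ((T : ℝ) - t)| ≤ ell η vC vk T := by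
  rw [ell, Real.abs_exp, ell]
  refine Real.exp_le_exp.mpr (mul_le_mul_of_nonneg_right ?_ (integral_nonneg fun _ => sq_nonneg _))
  linarith [t.coe_nonneg]

section Strategy

variable {ι : Type*} [Fintype ι] (C : ι) (T : ℝ≥0) (v : ι → ℝ → ℝ) (θ η : ℝ) (π : ι → ℝ)

/-- The coefficient of `z_k²` in a bound for `(ξ - α*(t, ξ, z))²`. -/
def retainedBound (k : ι) (ξ : ℝ) : ℝ :=
  (Fintype.card ι * (1 / θ * π k * ell η (v C) (v k) T) ^ 2) *
    (1 - jumpFactor η (v C) (v k) ξ) ^ 2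

/-- Cauchy–Schwarz over the finite index set gives the factor `Fintype.card ι`; the time dependence
disappears because ℓ is nondecreasing. -/
lemma sq_retained_le {t : ℝ≥0} (ξ : ℝ) (z : ι → ℝ) {U : ι → ℝ}
    (hz : ∀ k, |z k| ≤ U k) :
    (ξ - alphaStar C T v θ η π t ξ z) ^ 2 ≤ ∑ k, U k ^ 2 * retainedBound C T v θ η π k ξ := by
  have h1 : ξ - alphaStar C T v θ η π t ξ z = ∑ k, 1 / θ * (π k * z k *
      ell η (v C) (v k) ((T : ℝ) - t) * (jumpFactor η (v C) (v k) ξ - 1)) := by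
    rw [alphaStar, sub_sub_cancel, Finset.mul_sum]
    rfl
  rw [h1]
  refine (sq_sum_le_card_mul_sum_sq).trans ?_
  rw [Finset.mul_sum]
  refine Finset.sum_le_sum fun k _ => ?_
  have hz2 : z k ^ 2 ≤ U k ^ 2 := sq_le_sq.mpr ((hz k).trans (le_abs_self _))
  have hell : ell η (v C) (v k) ((T : ℝ) - t) ^ 2 ≤ ell η (v C) (v k) T ^ 2 :=
    sq_le_sq.mpr ((abs_ell_le η (v C) (v k)).trans (le_abs_self _))
  rw [retainedBound, Finset.card_univ]
  calc (Fintype.card ι : ℝ) * (1 / θ * (π k * z k * ell η (v C) (v k) ((T : ℝ) - t) *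
        (jumpFactor η (v C) (v k) ξ - 1))) ^ 2
      = Fintype.card ι * ((1 / θ * π k) ^ 2 * (1 - jumpFactor η (v C) (v k) ξ) ^ 2) *
          (z k ^ 2 * ell η (v C) (v k) ((T : ℝ) - t) ^ 2) := by ring
    _ ≤ Fintype.card ι * ((1 / θ * π k) ^ 2 * (1 - jumpFactor η (v C) (v k) ξ) ^ 2) *
          (U k ^ 2 * ell η (v C) (v k) T ^ 2) :=
        mul_le_mul_of_nonneg_left (mul_le_mul hz2 hell (sq_nonneg _) (sq_nonneg _)) (by positivity)
    _ = _ := by ring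

lemma squareIntegrableField_alphaStar {Ω : Type*} {mΩ : MeasurableSpace Ω} (P : Measure Ω)
    [IsFiniteMeasure P] (hv : ∀ k, Measurable (v k)) {ν : Measure ℝ} [IsFiniteMeasure ν]
    (hξ : Integrable (fun ξ => ξ ^ 2) ν)
    (hg2 : ∀ k, Integrable (fun ξ => jumpFactor η (v C) (v k) ξ ^ 2) ν) {U : ι → Ω → ℝ}
    (hU : ∀ k, Measurable (U k)) (hU2 : ∀ k, ∫⁻ ω, ENNReal.ofReal (U k ω ^ 2) ∂P < ∞)
    {z : ℝ≥0 → Ω → ι → ℝ} (hz : ∀ᵐ ω ∂P, ∀ k, ∀ t ≤ T, |z t ω k| ≤ U k ω) :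
    SquareIntegrableField P T ν (fun t ω ξ => alphaStar C T v θ η π t ξ (z t ω)) ∧
      SquareIntegrableField P T ν (fun t ω ξ => ξ - alphaStar C T v θ η π t ξ (z t ω)) := by
  have hbm : ∀ k, Measurable (retainedBound C T v θ η π k) := fun k =>
    (((measurable_jumpFactor η (hv C) (hv k)).const_sub 1).pow_const 2).const_mul _
  have hbi : ∀ k, Integrable (retainedBound C T v θ η π k) ν := fun k =>
    (integrable_one_sub_sq (measurable_jumpFactor η (hv C) (hv k)) (hg2 k)).const_mul _
  have hb0 : ∀ k ξ, 0 ≤ retainedBound C T v θ η π k ξ := fun k ξ => by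
    rw [retainedBound]; positivity
  constructor
  · refine squareIntegrableField_of_le P T (q₀ := fun ξ => 2 * ξ ^ 2)
      (q := fun k ξ => 2 * retainedBound C T v θ η π k ξ) (U := U) (hξ.const_mul 2) (by fun_prop)
      (fun ξ => by positivity) (fun k => (hbi k).const_mul 2) (fun k => (hbm k).const_mul 2)
      (fun k ξ => mul_nonneg zero_le_two (hb0 k ξ)) hU hU2 ?_
    filter_upwards [hz] with ω hω t ht ξ
    have h1 := sq_retained_le C T v θ η π (t := t) ξ (z t ω) fun k => hω k t ht
    have h2 : ∑ k, U k ω ^ 2 * (2 * retainedBound C T v θ η π k ξ) =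
        2 * ∑ k, U k ω ^ 2 * retainedBound C T v θ η π k ξ := by
      rw [Finset.mul_sum]
      exact Finset.sum_congr rfl fun k _ => by ring
    rw [h2]
    -- Here 2ξ² + 2(ξ - α)² - α² = (2ξ - α)².
    nlinarith [sq_nonneg (2 * ξ - alphaStar C T v θ η π t ξ (z t ω))]
  · refine squareIntegrableField_of_le P T (q₀ := fun _ => 0)
      (q := retainedBound C T v θ η π) (U := U) (integrable_zero _ _ _) measurable_const
      (fun ξ => le_rfl) hbi hbm hb0 hU hU2 ?_
    filter_upwards [hz] with ω hω t ht ξ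
    rw [zero_add]
    exact sq_retained_le C T v θ η π ξ (z t ω) fun k => hω k t ht

lemma measurable_alphaStar {X : Type*} [MeasurableSpace X] (hv : ∀ k, Measurable (v k))
    {t : X → ℝ≥0} (ht : Measurable t) {ξ : X → ℝ} (hξ : Measurable ξ) {z : ι → X → ℝ}
    (hz : ∀ k, Measurable (z k)) :
    Measurable fun a => alphaStar C T v θ η π (t a) (ξ a) fun k => z k a := by
  unfold alphaStar
  refine hξ.sub ((Finset.measurable_fun_sum _ fun k _ => ?_).const_mul _)
  refine (((hz k).const_mul _).mul ?_).mul ?_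
  · unfold ell
    exact ((measurable_const.sub ht.coe_nnreal_real).mul_const _).exp
  · exact ((((hv C).comp hξ).div ((hv k).comp hξ)).const_mul _).sub_const 1

lemma isPredictableField_alphaStar {Ω : Type*} {mΩ : MeasurableSpace Ω} (𝓕 : Filtration ℝ≥0 mΩ)
    (hv : ∀ k, Measurable (v k)) {Z : ι → ℝ≥0 → Ω → ℝ}
    (hZ : ∀ k, ∀ t ≤ T, Measurable[𝓕 t] (Z k t)) (hcad : ∀ k, IsCadlag T (Z k)) :
    IsPredictableField 𝓕 T fun t ω ξ => alphaStar C T v θ η π t ξ fun k => leftValue (Z k) t ω := by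
  let : MeasurableSpace (ℝ≥0 × Ω) := 𝓕.predictable
  have hT : MeasurableSet {p : (ℝ≥0 × Ω) × ℝ | p.1.1 ≤ T ∧ p.2 ∈ marks} :=
    (((measurable_predictable_fst 𝓕).comp measurable_fst) measurableSet_Iic).inter
      (measurable_snd measurableSet_Ioi)
  have hm : Measurable fun p : (ℝ≥0 × Ω) × ℝ => alphaStar C T v θ η π p.1.1 p.2 fun k =>
      {q : ℝ≥0 × Ω | q.1 ≤ T}.indicator (fun q => leftValue (Z k) q.1 q.2) p.1 :=
    measurable_alphaStar C T v θ η π hv ((measurable_predictable_fst 𝓕).comp measurable_fst)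
      measurable_snd fun k => (measurable_predictable_leftValue 𝓕 T (hZ k)
        fun ω => (hcad k ω).2).comp measurable_fst
  -- Left limits are known to be predictable only after truncation at T, which changes nothing
  -- inside the outer indicator.
  have heq : Set.indicator {p : (ℝ≥0 × Ω) × ℝ | p.1.1 ≤ T ∧ p.2 ∈ marks}
      (fun p => alphaStar C T v θ η π p.1.1 p.2 fun k => leftValue (Z k) p.1.1 p.1.2) =
      Set.indicator {p : (ℝ≥0 × Ω) × ℝ | p.1.1 ≤ T ∧ p.2 ∈ marks}
        fun p => alphaStar C T v θ η π p.1.1 p.2 fun k =>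
          {q : ℝ≥0 × Ω | q.1 ≤ T}.indicator (fun q => leftValue (Z k) q.1 q.2) p.1 := by
    refine Set.indicator_congr fun p hp => ?_
    congr 1
    funext k
    rw [Set.indicator_of_mem (show p.1 ∈ {q : ℝ≥0 × Ω | q.1 ≤ T} from hp.1)]
  rw [IsPredictableField, heq]
  exact hm.indicator hT

end Strategy

/-! ### The candidate compensator and positivity of the jump factor -/

lemma isPredictableField_betaStar {Ω : Type*} {mΩ : MeasurableSpace Ω} (𝓕 : Filtration ℝ≥0 mΩ)
    (T : ℝ≥0) {vC : ℝ → ℝ} (hv : Measurable vC) (η : ℝ) :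
    IsPredictableField 𝓕 T (betaStar (Ω := Ω) vC η) := by
  let : MeasurableSpace (ℝ≥0 × Ω) := 𝓕.predictable
  have hT : MeasurableSet {p : (ℝ≥0 × Ω) × ℝ | p.1.1 ≤ T ∧ p.2 ∈ marks} :=
    (((measurable_predictable_fst 𝓕).comp measurable_fst) measurableSet_Iic).inter
      (measurable_snd measurableSet_Ioi)
  have hm : Measurable fun p : (ℝ≥0 × Ω) × ℝ => (1 + η) * vC p.2 :=
    (hv.comp measurable_snd).const_mul _
  exact hm.indicator hT

lemma betaStar_div {Ω : Type*} (vC vk : ℝ → ℝ) (η : ℝ) (t : ℝ≥0) (ω : Ω) (ξ : ℝ) :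
    betaStar vC η t ω ξ / vk ξ = jumpFactor η vC vk ξ := by
  rw [betaStar, jumpFactor, mul_div_assoc]

/-- The marks at which two densities are both positive. -/
def positiveMarks (vC vk : ℝ → ℝ) : Set ℝ := marks ∩ ({ξ | 0 < vC ξ} ∩ {ξ | 0 < vk ξ})

lemma measurableSet_positiveMarks {vC vk : ℝ → ℝ} (hC : Measurable vC) (hk : Measurable vk) :
    MeasurableSet (positiveMarks vC vk) :=
  measurableSet_Ioi.inter ((measurableSet_lt measurable_const hC).inter
    (measurableSet_lt measurable_const hk))

lemma jumpFactor_pos {η : ℝ} (hη : 0 < η) {vC vk : ℝ → ℝ} {ξ : ℝ}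
    (hξ : ξ ∈ positiveMarks vC vk) : 0 < jumpFactor η vC vk ξ :=
  mul_pos (by linarith) (div_pos hξ.2.1 hξ.2.2)

/-- If `N` is a Poisson random measure under two equivalent probability measures, then the
compensator under the first one charges only marks where the density of the second is positive. -/
lemma compensatorMeasure_compl_positiveMarks {Ω : Type*} {mΩ : MeasurableSpace Ω}
    {𝓕 : Filtration ℝ≥0 mΩ} {P Q : Measure Ω} [IsProbabilityMeasure P]
    (hPQ : P ≪ Q) {T : ℝ≥0} (hT : 0 < T) {N : Ω → Measure (ℝ≥0 × ℝ)} {vC vk : ℝ → ℝ}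
    (hC : Measurable vC) (hk : Measurable vk) [IsFiniteMeasure (compensatorMeasure vC)]
    [IsFiniteMeasure (compensatorMeasure vk)]
    (hNQ : IsPoissonRandomMeasure 𝓕 Q T (compensatorMeasure vC) N)
    (hNP : IsPoissonRandomMeasure 𝓕 P T (compensatorMeasure vk) N) :
    compensatorMeasure vk (positiveMarks vC vk)ᶜ = 0 := by
  have hB : MeasurableSet (Set.Ioc 0 T ×ˢ {ξ | vC ξ ≤ 0}) :=
    measurableSet_Ioc.prod (measurableSet_le hC measurable_const)
  have h1 : compensatorMeasure vk {ξ | vC ξ ≤ 0} = 0 := by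
    have h0 : intensity T (compensatorMeasure vC) (Set.Ioc 0 T ×ˢ {ξ | vC ξ ≤ 0}) = 0 := by
      rw [intensity_Ioc_prod le_rfl, compensatorMeasure_setOf_nonpos hC, mul_zero]
    -- Absence of points in B passes from Q to P by absolute continuity, and back to the compensator
    -- under P through the void probability.
    have h2 := hNP.intensity_eq_zero hB (hPQ.ae_le (hNQ.ae_eq_zero hB h0))
    rw [intensity_Ioc_prod le_rfl, mul_eq_zero] at h2
    refine h2.resolve_left ?_
    rw [ENNReal.ofReal_eq_zero, not_le]
    simpa using hT
  refine measure_mono_null ?_ (measure_union_null (ae_mem_marks vk)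
    (measure_union_null h1 (compensatorMeasure_setOf_nonpos hk)))
  intro ξ hξ
  by_contra hcon
  simp only [Set.mem_union, not_or] at hcon
  have hC0 : 0 < vC ξ := not_le.mp hcon.2.1
  have hk0 : 0 < vk ξ := not_le.mp hcon.2.2
  exact hξ ⟨not_not.mp hcon.1, hC0, hk0⟩

end RiskSharing

end

/-! ### The proposition -/

theorem mainTheorem4 {Ω : Type*} {mΩ : MeasurableSpace Ω} {ι : Type*} [Fintype ι]
    -- the index of the counterparty; the other indices are those of the insurer's models
    (C : ι)
    (𝓕 : Filtration ℝ≥0 mΩ) (P : ι → Measure Ω) (hP : ∀ k, IsProbabilityMeasure (P k))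
    (hequiv : ∀ j k, P j ≪ P k)
    (hcomplete : ∀ s, P C s = 0 → MeasurableSet[𝓕 0] s)
    (T : ℝ≥0) (hT : 0 < T)
    (v : ι → ℝ → ℝ) (hv_meas : ∀ k, Measurable (v k))
    (hv_nonneg : ∀ k, ∀ ξ ∈ RiskSharing.marks, 0 ≤ v k ξ)
    (hv_int : ∀ k, IntegrableOn (v k) RiskSharing.marks)
    (hv_int1 : ∀ k, IntegrableOn (fun ξ => ξ * v k ξ) RiskSharing.marks)
    (hv_int2 : IntegrableOn (fun ξ => ξ ^ 2 * v C ξ) RiskSharing.marks)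
    (N : Ω → Measure (ℝ≥0 × ℝ))
    (hN : ∀ k, RiskSharing.IsPoissonRandomMeasure 𝓕 (P k) T
      (RiskSharing.compensatorMeasure (v k)) N)
    (θ η : ℝ) (hθ : 0 < θ) (hη : 0 < η)
    (π : ι → ℝ) (hπ : ∀ k, 0 ≤ π k ∧ π k ≤ 1) (hπ_sum : ∑ k, π k = 1)
    (hA1 : ∀ k, IntegrableOn (fun ξ => v C ξ ^ 2 / v k ξ) RiskSharing.marks)
    (hA2 : ∀ j k, IntegrableOn (fun ξ => v C ξ ^ 3 / (v j ξ * v k ξ)) RiskSharing.marks) :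
    -- the compensator is admissible
    RiskSharing.AdmissibleCompensator 𝓕 P T v N (RiskSharing.betaStar (v C) η) ∧
    -- the auxiliary processes are true martingale densities with finite second moments
    (∀ k Z, RiskSharing.IsAuxiliaryProcess 𝓕 (P k) T (v k) N (RiskSharing.betaStar (v C) η) Z →
      (∀ᵐ ω ∂(P k), ∀ t ≤ T, 0 ≤ Z t ω) ∧
      Martingale (fun t => Z (min t T)) 𝓕 (P k) ∧
      ∫ ω, Z T ω ∂(P k) = 1 ∧
      MemLp (Z T) 2 (P k)) ∧
    -- the strategy is admissible, as a predictable field and also with `Z_t` in place of `Z_{t-}`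
    (∀ Z : ι → ℝ≥0 → Ω → ℝ,
      (∀ k, RiskSharing.IsAuxiliaryProcess 𝓕 (P k) T (v k) N
        (RiskSharing.betaStar (v C) η) (Z k)) →
      RiskSharing.AdmissibleStrategy 𝓕 (P C) T (v C)
        (fun t ω ξ => RiskSharing.alphaStar C T v θ η π t ξ
          fun k => RiskSharing.leftValue (Z k) t ω) ∧
      RiskSharing.SquareIntegrableField (P C) T (RiskSharing.compensatorMeasure (v C))
        (fun t ω ξ => RiskSharing.alphaStar C T v θ η π t ξ fun k => Z k t ω) ∧
      RiskSharing.SquareIntegrableField (P C) T (RiskSharing.compensatorMeasure (v C))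
        (fun t ω ξ => ξ - RiskSharing.alphaStar C T v θ η π t ξ fun k => Z k t ω)) := by
  have hfin : ∀ k, IsFiniteMeasure (RiskSharing.compensatorMeasure (v k)) := fun k =>
    RiskSharing.isFiniteMeasure_compensatorMeasure (hv_meas k) (hv_nonneg k) (hv_int k)
  set g : ι → ℝ → ℝ := fun k => RiskSharing.jumpFactor η (v C) (v k) with hg_def
  have hβ : ∀ k t (ω : Ω) ξ, RiskSharing.betaStar (v C) η t ω ξ / v k ξ = g k ξ := fun k =>
    RiskSharing.betaStar_div (v C) (v k) η
  have hg : ∀ k, Measurable (g k) := fun k =>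
    RiskSharing.measurable_jumpFactor η (hv_meas C) (hv_meas k)
  have hg2 : ∀ k, Integrable (fun ξ => g k ξ ^ 2) (RiskSharing.compensatorMeasure (v k)) := by
    intro k
    refine (RiskSharing.integrable_compensatorMeasure_iff (hv_meas k) (hv_nonneg k)).mpr
      (((hA1 k).const_mul ((1 + η) ^ 2)).congr (ae_of_all _ fun ξ => ?_))
    simp only [hg_def, RiskSharing.jumpFactor]
    rcases eq_or_ne (v k ξ) 0 with h | h
    · simp [h]
    · field_simp
  -- Against ν_C the square of g_k has density (1 + η)² v_C³ / v_k², so the third-power assumption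
  -- enters with j = k. Where v_k = 0 both sides are 0 by the division convention.
  have hg2C : ∀ k, Integrable (fun ξ => g k ξ ^ 2) (RiskSharing.compensatorMeasure (v C)) := by
    intro k
    refine (RiskSharing.integrable_compensatorMeasure_iff (hv_meas C) (hv_nonneg C)).mpr
      (((hA2 k k).const_mul ((1 + η) ^ 2)).congr (ae_of_all _ fun ξ => ?_))
    simp only [hg_def, RiskSharing.jumpFactor]
    rcases eq_or_ne (v k ξ) 0 with h | h
    · simp [h]
    · field_simp
  have hgint : ∀ k, Integrable (g k) (RiskSharing.compensatorMeasure (v k)) := fun k =>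
    RiskSharing.integrable_of_integrable_sq (hg k) (hg2 k)
  have hE : ∀ k, MeasurableSet (RiskSharing.positiveMarks (v C) (v k)) := fun k =>
    RiskSharing.measurableSet_positiveMarks (hv_meas C) (hv_meas k)
  have hEnull : ∀ k, RiskSharing.compensatorMeasure (v k)
      (RiskSharing.positiveMarks (v C) (v k))ᶜ = 0 := fun k =>
    RiskSharing.compensatorMeasure_compl_positiveMarks (hequiv k C) hT (hv_meas C) (hv_meas k)
      (hN C) (hN k)
  have hEpos : ∀ k, ∀ ξ ∈ RiskSharing.positiveMarks (v C) (v k), 0 < g k ξ := fun k ξ hξ =>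
    RiskSharing.jumpFactor_pos hη hξ
  have hexists : ∀ k, ∃ Z, RiskSharing.IsAuxiliaryProcess 𝓕 (P k) T (v k) N
      (RiskSharing.betaStar (v C) η) Z ∧ ∀ᵐ ω ∂(P k), ∀ t, Z t ω =
        RiskSharing.jumpProcess (∫ ξ, (1 - g k ξ) ∂(RiskSharing.compensatorMeasure (v k)))
          (g k) N t ω := fun k =>
    RiskSharing.exists_isAuxiliaryProcess (hN k) (fun s hs => hcomplete s (hequiv C k hs)) (hβ k)
      (hg k) (hgint k) (hE k) (hEnull k) fun ξ hξ => ⟨hξ.1, hEpos k ξ hξ⟩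
  have hformula : ∀ k Z, RiskSharing.IsAuxiliaryProcess 𝓕 (P k) T (v k) N
      (RiskSharing.betaStar (v C) η) Z → ∀ᵐ ω ∂(P k), ∀ t ≤ T, Z t ω =
        RiskSharing.jumpProcess (∫ ξ, (1 - g k ξ) ∂(RiskSharing.compensatorMeasure (v k)))
          (g k) N t ω := by
    intro k Z hZ
    obtain ⟨W, hW, hWeq⟩ := hexists k
    filter_upwards [hZ.ae_eq (hN k) (hβ k) (hgint k) hW, hWeq] with ω h1 h2 t ht
    rw [h1 t ht, h2 t]
  have hmain : ∀ k Z, RiskSharing.IsAuxiliaryProcess 𝓕 (P k) T (v k) N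
      (RiskSharing.betaStar (v C) η) Z →
      (∀ᵐ ω ∂(P k), ∀ t ≤ T, 0 ≤ Z t ω) ∧ Martingale (fun t => Z (min t T)) 𝓕 (P k) ∧
      ∫ ω, Z T ω ∂(P k) = 1 ∧ MemLp (Z T) 2 (P k) := by
    intro k Z hZ
    have hZf := hformula k Z hZ
    refine ⟨?_, ?_, ?_, ?_⟩
    · filter_upwards [hZf] with ω hω t ht
      rw [hω t ht]
      exact (Real.exp_pos _).le
    · exact RiskSharing.martingale_of_ae_eq_jumpProcess (hN k) (hE k) (hEnull k) (hEpos k) (hg k)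
        (hgint k) (hg2 k) hZf hZ.adapted
    · exact RiskSharing.integral_of_ae_eq_jumpProcess (hN k) (hE k) (hEnull k) (hEpos k) (hg k)
        (hgint k) hZf
    · exact RiskSharing.memLp_of_ae_eq_jumpProcess (hN k) (hE k) (hEnull k) (hEpos k) (hg k)
        (hg2 k) hZf hZ.adapted le_rfl
  refine ⟨⟨⟨?_, ?_, ?_⟩, ?_⟩, hmain, ?_⟩
  · exact RiskSharing.isPredictableField_betaStar 𝓕 T (hv_meas C) η
  · intro t _ ω ξ hξ
    exact mul_nonneg (by linarith) (hv_nonneg C ξ hξ)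
  · intro k
    simp only [hβ]
    exact RiskSharing.squareIntegrableField_of_const (P k) T
      (RiskSharing.integrable_one_sub_sq (hg k) (hg2 k))
  · intro k
    obtain ⟨Z, hZ, -⟩ := hexists k
    exact ⟨Z, hZ, (hmain k Z hZ).2.2⟩
  · intro Z hZ
    -- The bound on Z_k holds almost surely under P_k and moves to P_C by equivalence; its second
    -- moment is then computed under P_C with ν_C.
    have hbound : ∀ᵐ ω ∂(P C), ∀ k, ∀ t ≤ T, |Z k t ω| ≤ RiskSharing.jumpBound
        (∫ ξ, (1 - g k ξ) ∂(RiskSharing.compensatorMeasure (v k))) T (g k) N ω :=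
      ae_all_iff.mpr fun k => (hequiv C k).ae_le (RiskSharing.ae_abs_le_jumpBound (hN k) (hE k)
        (hEnull k) (hEpos k) (hformula k (Z k) (hZ k)))
    have hξ : Integrable (fun ξ => ξ ^ 2) (RiskSharing.compensatorMeasure (v C)) := by
      refine (RiskSharing.integrable_compensatorMeasure_iff (hv_meas C) (hv_nonneg C)).mpr ?_
      simpa only [mul_comm] using hv_int2
    have hsq := fun (z : ℝ≥0 → Ω → ι → ℝ) (hz : ∀ᵐ ω ∂(P C), ∀ k, ∀ t ≤ T, |z t ω k| ≤ _) =>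
      RiskSharing.squareIntegrableField_alphaStar C T v θ η π (P C) hv_meas hξ hg2C
        (fun k => RiskSharing.measurable_jumpBound (hN C)
          (∫ ξ, (1 - g k ξ) ∂(RiskSharing.compensatorMeasure (v k))) (hg k))
        (fun k => RiskSharing.lintegral_jumpBound_sq_lt_top (hN C) _ (hg k) (hg2C k))
        (z := z) hz
    have hleft := hsq (fun t ω k => RiskSharing.leftValue (Z k) t ω) (by
      filter_upwards [hbound] with ω hω k
      exact RiskSharing.abs_leftValue_le (hZ k).cadlag (hω k))
    have hright := hsq (fun t ω k => Z k t ω) hbound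
    exact ⟨⟨RiskSharing.isPredictableField_alphaStar C T v θ η π 𝓕 hv_meas
      (fun k => (hZ k).adapted) fun k => (hZ k).cadlag, hleft.1, hleft.2⟩, hright.1, hright.2⟩
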